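/- Let $\Bbbk$ be an algebraically closed field, let $V$ be a $\Bbbk$-vector space of dimension $n+1$ with $n\ge 1$, and let $R=\bigwedge V$ be the exterior algebra, graded with $V$ in degree $1$. Modules are finitely generated $\mathbb Z$-graded $R$-modules and homomorphisms have degree zero; $\operatorname{Ext}^i_R(-,-)$ denotes the derived functors of this graded $\operatorname{Hom}_R$, and a nonzero module is indecomposable if it is not a direct sum of two nonzero graded submodules. For a module $X$ let $\cdots\to F^2\to F^1\to F^0\to X\to 0$ be its minimal graded free resolution. The module $X$ is called linear if each $F^i$ is generated in degree $i$. The complexity of $X$ is the infimum of the set of all $m\in\mathbb N$ for which there is a positive $c\in\mathbb Q$ with $\operatorname{rank} F^i\le c\,i^{m-1}$ for all $i\ge 1$. Let $X$ be an indecomposable linear $R$-module of complexity one. Then $\operatorname{Ext}^1_R(X,X)\ne 0$. -/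

import Mathlib

open scoped DirectSum

noncomputable section

namespace ExteriorModules

/-- The exterior algebra as a `ℤ`-graded algebra: `⋀^i V` in degree `i ≥ 0`, zero in negative
degrees. -/
def extGrading (k V : Type*) [Field k] [AddCommGroup V] [Module k V] :
    ℤ → Submodule k (ExteriorAlgebra k V)
  | Int.ofNat i => ⋀[k]^i V
  | Int.negSucc _ => ⊥

/-- The submodule of homogeneous elements of degree `j` in the graded free module
`⨁ₐ R(-deg a)`: the basis vector with index `a` is placed in degree `deg a`. -/
def freeGrading (k V : Type*) [Field k] [AddCommGroup V] [Module k V] {m : ℕ}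
    (deg : Fin m → ℤ) (j : ℤ) : Submodule k (Fin m → ExteriorAlgebra k V) where
  carrier := {f | ∀ a, f a ∈ extGrading k V (j - deg a)}
  add_mem' hf hg a := add_mem (hf a) (hg a)
  zero_mem' _ := zero_mem _
  smul_mem' c _ hf a := Submodule.smul_mem _ c (hf a)

section

variable {k V X Y : Type*} [Field k] [AddCommGroup V] [Module k V]
  [AddCommGroup X] [Module k X] [Module (ExteriorAlgebra k V) X]
  [AddCommGroup Y] [Module k Y] [Module (ExteriorAlgebra k V) Y]

variable (V) in
/-- `Hom_R(X, Y)`: the `k`-space of homomorphisms of degree zero between the graded modules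
`(X, 𝒳)` and `(Y, 𝒴)`. -/
def gradedHom [IsScalarTower k (ExteriorAlgebra k V) Y]
    (𝒳 : ℤ → Submodule k X) (𝒴 : ℤ → Submodule k Y) :
    Submodule k (X →ₗ[ExteriorAlgebra k V] Y) where
  carrier := {f | ∀ j, ∀ x ∈ 𝒳 j, f x ∈ 𝒴 j}
  add_mem' hf hg j x hx := add_mem (hf j x hx) (hg j x hx)
  zero_mem' _ _ _ := zero_mem _
  smul_mem' c _ hf j x hx := Submodule.smul_mem _ c (hf j x hx)

variable (V) in
/-- A graded module is indecomposable if it is nonzero and is not the direct sum of two nonzero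
graded submodules. -/
def IsGradedIndecomposable (𝒳 : ℤ → Submodule k X) [DirectSum.Decomposition 𝒳] : Prop :=
  Nontrivial X ∧ ∀ A B : Submodule (ExteriorAlgebra k V) X,
    A.IsHomogeneous 𝒳 → B.IsHomogeneous 𝒳 → IsCompl A B → A = ⊥ ∨ B = ⊥

variable (V) in
/-- A resolution `⋯ → F¹ → F⁰ → X → 0` of the graded module `(X, 𝒳)` by finitely generated graded
free modules `Fⁱ = ⨁ₐ R(-deg i a)`, with all maps of degree zero. -/
structure GradedFreeResolution [IsScalarTower k (ExteriorAlgebra k V) X]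
    (𝒳 : ℤ → Submodule k X) where
  /-- the rank of `Fⁱ` -/
  rank : ℕ → ℕ
  /-- the degrees of the basis vectors of `Fⁱ` -/
  deg : ∀ i, Fin (rank i) → ℤ
  /-- the differential `Fⁱ⁺¹ → Fⁱ` -/
  d : ∀ i, (Fin (rank (i + 1)) → ExteriorAlgebra k V) →ₗ[ExteriorAlgebra k V]
    (Fin (rank i) → ExteriorAlgebra k V)
  /-- the augmentation `F⁰ → X` -/
  aug : (Fin (rank 0) → ExteriorAlgebra k V) →ₗ[ExteriorAlgebra k V] X
  d_mem : ∀ i, d i ∈ gradedHom V (freeGrading k V (deg (i + 1))) (freeGrading k V (deg i))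
  aug_mem : aug ∈ gradedHom V (freeGrading k V (deg 0)) 𝒳
  aug_surjective : Function.Surjective aug
  exact_aug : Function.Exact (d 0) aug
  exact_d : ∀ i, Function.Exact (d (i + 1)) (d i)

namespace GradedFreeResolution

variable [IsScalarTower k (ExteriorAlgebra k V) X] [IsScalarTower k (ExteriorAlgebra k V) Y]
  {𝒳 : ℤ → Submodule k X}

/-- The resolution is minimal: the image of each differential lies in `J Fⁱ`, where `J`, the
radical of the exterior algebra, is the kernel of the augmentation `R → k`. -/
def IsMinimal (F : GradedFreeResolution V 𝒳) : Prop :=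
  ∀ i x a, ExteriorAlgebra.algebraMapInv (F.d i x a) = 0

/-- The `k`-space `Hom_R(Fⁱ, Y)` of homomorphisms of degree zero. -/
def Cochains (F : GradedFreeResolution V 𝒳) (𝒴 : ℤ → Submodule k Y) (i : ℕ) : Type _ :=
  gradedHom V (freeGrading k V (F.deg i)) 𝒴

instance (F : GradedFreeResolution V 𝒳) (𝒴 : ℤ → Submodule k Y) (i : ℕ) :
    AddCommGroup (F.Cochains 𝒴 i) :=
  inferInstanceAs (AddCommGroup (gradedHom V (freeGrading k V (F.deg i)) 𝒴))

instance (F : GradedFreeResolution V 𝒳) (𝒴 : ℤ → Submodule k Y) (i : ℕ) :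
    Module k (F.Cochains 𝒴 i) :=
  inferInstanceAs (Module k (gradedHom V (freeGrading k V (F.deg i)) 𝒴))

/-- The coboundary `Hom_R(Fⁱ, Y) → Hom_R(Fⁱ⁺¹, Y)`, `g ↦ g ∘ d`. -/
def coboundary (F : GradedFreeResolution V 𝒳) (𝒴 : ℤ → Submodule k Y) (i : ℕ) :
    F.Cochains 𝒴 i →ₗ[k] F.Cochains 𝒴 (i + 1) where
  toFun g := ⟨g.1 ∘ₗ F.d i, fun j x hx => g.2 j _ (F.d_mem i j x hx)⟩
  map_add' _ _ := rfl
  map_smul' _ _ := rfl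

/-- The image of `Hom_R(Fⁱ⁻¹, Y) → Hom_R(Fⁱ, Y)` (zero for `i = 0`). -/
def coboundaries (F : GradedFreeResolution V 𝒳) (𝒴 : ℤ → Submodule k Y) :
    ∀ i : ℕ, Submodule k (F.Cochains 𝒴 i)
  | 0 => ⊥
  | i + 1 => LinearMap.range (F.coboundary 𝒴 i)

/-- `Extⁱ_R(X, Y)`, the `i`-th right derived functor of the graded Hom, computed from the graded
free resolution `F` of `X`: the `i`-th cohomology of the complex `Hom_R(F, Y)`. -/
abbrev Ext (F : GradedFreeResolution V 𝒳) (𝒴 : ℤ → Submodule k Y) (i : ℕ) : Type _ :=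
  LinearMap.ker (F.coboundary 𝒴 i) ⧸
    (F.coboundaries 𝒴 i).submoduleOf (LinearMap.ker (F.coboundary 𝒴 i))

end GradedFreeResolution

variable (V) in
/-- A linear module: in its minimal graded free resolution (unique up to isomorphism) each `Fⁱ` is
generated in degree `i`. -/
def IsLinearModule [IsScalarTower k (ExteriorAlgebra k V) X] (𝒳 : ℤ → Submodule k X) : Prop :=
  ∃ F : GradedFreeResolution V 𝒳, F.IsMinimal ∧ ∀ i a, F.deg i a = i

variable (V) in
/-- The complexity: the infimum of all `m ∈ ℕ` such that the Betti numbers `βᵢ` (the ranks in the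
minimal graded free resolution) satisfy `βᵢ ≤ c i ^ (m - 1)` for some positive `c ∈ ℚ` and all
`i ≥ 1`. -/
def complexity [IsScalarTower k (ExteriorAlgebra k V) X] (𝒳 : ℤ → Submodule k X) : ℕ∞ :=
  ⨅ m ∈ {m : ℕ | ∃ F : GradedFreeResolution V 𝒳, F.IsMinimal ∧
    ∃ c : ℚ, 0 < c ∧ ∀ i : ℕ, 1 ≤ i → (F.rank i : ℚ) ≤ c * (i : ℚ) ^ ((m : ℤ) - 1)}, (m : ℕ∞)

end

end ExteriorModules

end

/-! Write the linear resolution as matrices D_i with entries in V, and let b_i be its ranks.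
Evaluating the entries at linear forms makes ⨁ k^{b_i} a graded module over the symmetric algebra of
V*. The relation d² = 0 makes the forms commute (`sum_eval_mul_eval_comm`), and minimality makes
degree zero generate (`iSup_range_mulVec_eq_top`). Complexity one bounds the b_i, so a generic form
l acts bijectively in large degrees (`exists_bijective_pencil`). Choose v with l(v) = 1 and put H =
ker l.

Exactness of the resolution carries this bijectivity down to degree zero
(`exists_linear_form_of_linear_complex`). This needs the top exterior power to kill the generators
of X; otherwise X would be free of rank one, since a generator not killed splits off
(`bijective_smul_of_top_smul_ne_zero`), and its complexity would be zero. Consequently X_0 generates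
X over ⋀H, and every nonzero h in H acts injectively on X_0.

Fix such an h and suppose Ext¹(X, X) = 0, so that graded derivations from R to End X are inner
(`exists_commutator_eq_of_ext_subsingleton`). Let C be the finite-dimensional space of degree zero
endomorphisms f that commute with H and satisfy h f v = h v f. For f in C, sending H to 0 and v to h
f extends to a derivation. It is therefore the commutator with some p, so [p, v] = h f, and h² = 0
puts p back in C. The linear relation [p, v] = h f on C thus has surjective second projection. Its
first projection is injective: h f = 0 forces f = 0 on X_0, hence everywhere. Counting dimensions,
the second projection is injective too (`eq_zero_of_mem_relation`). But (id, 0) lies in the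
relation, so id = 0, contradicting X ≠ 0. -/

namespace ExteriorModules

open ExteriorAlgebra

/-! ### Contraction and annihilators in the exterior algebra. -/

section Contraction

variable {k V : Type*} [Field k] [AddCommGroup V] [Module k V]

/-- Contraction of an element of the exterior algebra with a linear form. -/
def contract (f : Module.Dual k V) : ExteriorAlgebra k V →ₗ[k] ExteriorAlgebra k V :=
  CliffordAlgebra.contractLeft (Q := (0 : QuadraticForm k V)) f

@[simp]
theorem contract_ι_mul (f : Module.Dual k V) (u : V) (r : ExteriorAlgebra k V) :
    contract f (ι k u * r) = f u • r - ι k u * contract f r :=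
  CliffordAlgebra.contractLeft_ι_mul ..

@[simp]
theorem contract_algebraMap (f : Module.Dual k V) (c : k) :
    contract f (algebraMap k (ExteriorAlgebra k V) c) = 0 :=
  CliffordAlgebra.contractLeft_algebraMap ..

@[simp]
theorem contract_ι (f : Module.Dual k V) (u : V) :
    contract f (ι k u) = algebraMap k (ExteriorAlgebra k V) (f u) :=
  CliffordAlgebra.contractLeft_ι ..

theorem ι_mem_exteriorPower_one (u : V) : ι k u ∈ ⋀[k]^1 V := by
  rw [exteriorPower, pow_one]
  exact LinearMap.mem_range_self _ _

theorem ι_mul_mem {p : ℕ} (u : V) {r : ExteriorAlgebra k V} (hr : r ∈ ⋀[k]^p V) :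
    ι k u * r ∈ ⋀[k]^(p + 1) V := by
  rw [exteriorPower, pow_succ']
  exact Submodule.mul_mem_mul (LinearMap.mem_range_self _ _) hr

theorem exteriorPower_zero_eq_algebraMap {r : ExteriorAlgebra k V} (hr : r ∈ ⋀[k]^0 V) :
    ∃ c : k, algebraMap k _ c = r := by
  rwa [exteriorPower, pow_zero, Submodule.mem_one] at hr

theorem contract_mem (f : Module.Dual k V) {p : ℕ} {r : ExteriorAlgebra k V}
    (hr : r ∈ ⋀[k]^(p + 1) V) : contract f r ∈ ⋀[k]^p V := by
  induction p generalizing r with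
  | zero =>
    rw [exteriorPower, zero_add, pow_one] at hr
    obtain ⟨u, rfl⟩ := hr
    rw [contract_ι, exteriorPower, pow_zero]
    exact Submodule.algebraMap_mem _
  | succ p ih =>
    rw [exteriorPower, pow_succ'] at hr
    induction hr using Submodule.mul_induction_on' with
    | mem_mul_mem m hm x hx =>
      obtain ⟨u, rfl⟩ := hm
      rw [contract_ι_mul]
      exact sub_mem (Submodule.smul_mem _ _ hx) (ι_mul_mem u (ih hx))
    | add x _ y _ hx hy => rw [map_add]; exact add_mem hx hy

theorem ι_mul_comm_of_mem {p : ℕ} (u : V) {r : ExteriorAlgebra k V} (hr : r ∈ ⋀[k]^p V) :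
    r * ι k u = (-1 : k) ^ p • (ι k u * r) := by
  induction p generalizing r with
  | zero =>
    obtain ⟨c, rfl⟩ := exteriorPower_zero_eq_algebraMap hr
    rw [pow_zero, one_smul, Algebra.commutes]
  | succ p ih =>
    rw [exteriorPower, pow_succ'] at hr
    induction hr using Submodule.mul_induction_on' with
    | mem_mul_mem m hm x hx =>
      obtain ⟨w, rfl⟩ := hm
      rw [mul_assoc, ih hx, mul_smul_comm, ← mul_assoc, ← mul_assoc,
        eq_neg_of_add_eq_zero_left (ι_add_mul_swap w u), pow_succ, mul_neg_one, neg_smul, neg_mul,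
        smul_neg]
    | add x _ y _ hx hy => rw [add_mul, hx, hy, mul_add, smul_add]

/-- Contraction is a contracting homotopy for left multiplication by u, so the Koszul complex of u
is exact. -/
theorem ι_mul_contract {f : Module.Dual k V} {u : V} (hu : f u = 1) {r : ExteriorAlgebra k V}
    (hr : ι k u * r = 0) : ι k u * contract f r = r := by
  have := contract_ι_mul f u r
  rw [hr, map_zero, hu, one_smul] at this
  exact (sub_eq_zero.1 this.symm).symm

/-- A homogeneous element of degree less than `dim U` annihilated by `U` is zero. -/
theorem eq_zero_of_ι_mul_eq_zero {p : ℕ} (U : Submodule k V) [FiniteDimensional k U]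
    (hU : p < Module.finrank k U) {r : ExteriorAlgebra k V} (hr : r ∈ ⋀[k]^p V)
    (h : ∀ u ∈ U, ι k u * r = 0) : r = 0 := by
  induction p generalizing U r with
  | zero =>
    obtain ⟨c, rfl⟩ := exteriorPower_zero_eq_algebraMap hr
    obtain ⟨u, hu⟩ := Module.finrank_pos_iff_exists_ne_zero.1 hU
    have := h u u.2
    rw [← Algebra.commutes, ← Algebra.smul_def, smul_eq_zero, ι_eq_zero_iff] at this
    rcases this with rfl | h0
    · simp
    · exact absurd (Subtype.ext h0) hu
  | succ p ih =>
    obtain ⟨u, hu⟩ := Module.finrank_pos_iff_exists_ne_zero.1 (Nat.zero_lt_of_lt hU)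
    obtain ⟨f, hf⟩ := Module.Projective.exists_dual_ne_zero k
      (show (u : V) ≠ 0 from fun h0 => hu (Subtype.ext h0))
    obtain ⟨g, hg⟩ : ∃ g : Module.Dual k V, g u = 1 := ⟨(f u)⁻¹ • f, by simp [hf]⟩
    -- The contraction has degree p and is killed by U ∩ ker g, which loses at most one dimension,
    -- so the induction hypothesis applies.
    have hz : contract g r = 0 := by
      refine ih (U ⊓ LinearMap.ker g) ?_ (contract_mem g hr) ?_
      · have e := LinearMap.finrank_range_add_finrank_ker (g.domRestrict U)
        have h1 : Module.finrank k (LinearMap.range (g.domRestrict U)) ≤ 1 :=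
          (Submodule.finrank_le _).trans (Module.finrank_self k).le
        have h2 : Module.finrank k (LinearMap.ker (g.domRestrict U)) ≤
            Module.finrank k (U ⊓ LinearMap.ker g : Submodule k V) := by
          rw [LinearMap.ker_domRestrict]
          refine LinearMap.finrank_le_finrank_of_injective
            (f := (U.subtype.comp (Submodule.subtype _)).codRestrict
              (U ⊓ LinearMap.ker g) fun x => ⟨x.1.2, x.2⟩) ?_
          intro x y hxy
          have h3 := congrArg (fun z : (U ⊓ LinearMap.ker g : Submodule k V) => (z : V)) hxy
          exact Subtype.ext (Subtype.ext h3)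
        omega
      · rintro w ⟨hw, hgw⟩
        have := contract_ι_mul g w r
        rw [h w hw, map_zero, LinearMap.mem_ker.1 hgw, zero_smul, zero_sub] at this
        exact neg_eq_zero.1 this.symm
    rw [← ι_mul_contract hg (h u u.2), hz, mul_zero]

theorem contract_eq_zero_of_mem_ker_pow (f : Module.Dual k V) {p : ℕ} {r : ExteriorAlgebra k V}
    (hr : r ∈ ((LinearMap.ker f).map (ι k)) ^ p) : contract f r = 0 := by
  induction hr using Submodule.pow_induction_on_left' with
  | algebraMap c => simp
  | add x y i _ _ hx hy => rw [map_add, hx, hy, add_zero]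
  | mem_mul m hm i x _ ih =>
    obtain ⟨u, hu, rfl⟩ := hm
    rw [contract_ι_mul, ih, LinearMap.mem_ker.1 hu, zero_smul, mul_zero, sub_zero]

theorem ker_pow_le (f : Module.Dual k V) (p : ℕ) :
    ((LinearMap.ker f).map (ι k)) ^ p ≤ ⋀[k]^p V :=
  pow_le_pow_left₀ bot_le (LinearMap.map_le_range) p

end Contraction

/-! ### The top exterior power. -/

section Top

variable {k V : Type*} [Field k] [AddCommGroup V] [Module k V]

theorem exteriorPower_eq_bot [FiniteDimensional k V] {p : ℕ} (hp : Module.finrank k V < p) :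
    ⋀[k]^p V = ⊥ := by
  rw [← Submodule.finrank_eq_zero (R := k), exteriorPower.finrank_eq, Nat.choose_eq_zero_of_lt hp]

instance finite_exteriorAlgebra [FiniteDimensional k V] :
    Module.Finite k (ExteriorAlgebra k V) :=
  Module.Finite.of_basis (Module.finBasis k V).ExteriorAlgebra

theorem exists_top_element {d : ℕ} [FiniteDimensional k V] (hd : Module.finrank k V = d) :
    ∃ Ω ∈ ⋀[k]^d V, Ω ≠ 0 ∧ ∀ r ∈ ⋀[k]^d V, ∃ c : k, r = c • Ω := by
  have h1 : Module.finrank k (⋀[k]^d V) = 1 := by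
    rw [exteriorPower.finrank_eq, hd, Nat.choose_self]
  obtain ⟨⟨Ω, hΩ⟩, h0, h⟩ := finrank_eq_one_iff'.1 h1
  refine ⟨Ω, hΩ, fun h' => h0 (Subtype.ext h'), fun r hr => ?_⟩
  obtain ⟨c, hc⟩ := h ⟨r, hr⟩
  exact ⟨c, (congrArg Subtype.val hc).symm⟩

end Top

/-! ### Generation over the exterior algebra of a hyperplane. -/

section Generation

variable {k V Q : Type*} [Field k] [AddCommGroup V] [Module k V]
  [AddCommGroup Q] [Module k Q] [Module (ExteriorAlgebra k V) Q]
  [IsScalarTower k (ExteriorAlgebra k V) Q]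

theorem pow_succ_smul (I : Submodule k (ExteriorAlgebra k V)) (S : Submodule k Q) (p : ℕ) :
    I ^ (p + 1) • S = I • I ^ p • S := by
  rw [pow_succ', ← smul_eq_mul]
  exact Submodule.smul_assoc _ _ _

/-- The vector v anticommutes past each factor from the hyperplane until it reaches S, where it can
be traded for a hyperplane vector. -/
theorem ι_smul_mem_ker_pow_smul {f : Module.Dual k V} {v : V} {S : Submodule k Q}
    (hS : ∀ x ∈ S, ι k v • x ∈ (LinearMap.ker f).map (ι k) • S) (p : ℕ) :
    ∀ x ∈ ((LinearMap.ker f).map (ι k)) ^ p • S,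
      ι k v • x ∈ ((LinearMap.ker f).map (ι k)) ^ (p + 1) • S := by
  induction p with
  | zero =>
    intro x hx
    rw [pow_zero, Submodule.one_smul] at hx
    rw [zero_add, pow_one]
    exact hS x hx
  | succ p ih =>
    intro x hx
    rw [pow_succ_smul] at hx ⊢
    refine Submodule.smul_induction_on hx ?_ fun x y hx hy => by
      rw [smul_add]; exact add_mem hx hy
    rintro _ ⟨u, hu, rfl⟩ y hy
    rw [← mul_smul, eq_neg_of_add_eq_zero_left (ι_add_mul_swap v u), neg_smul, mul_smul]
    exact neg_mem (Submodule.smul_mem_smul ⟨u, hu, rfl⟩ (ih y hy))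

/-- If `v S ⊆ H S` with `V = k v ⊕ H`, then `(⋀^p V) S = (⋀^p H) S`. -/
theorem exteriorPower_smul_le {f : Module.Dual k V} {v : V} (hv : f v = 1) {S : Submodule k Q}
    (hS : ∀ x ∈ S, ι k v • x ∈ (LinearMap.ker f).map (ι k) • S) (p : ℕ) :
    (⋀[k]^p V) • S ≤ ((LinearMap.ker f).map (ι k)) ^ p • S := by
  induction p with
  | zero => rw [exteriorPower, pow_zero, pow_zero]
  | succ p ih =>
    rw [exteriorPower, pow_succ_smul, Submodule.smul_le]
    rintro _ ⟨u, rfl⟩ y hy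
    have hy' := ih hy
    have hu : u = (u - f u • v) + f u • v := by simp
    rw [hu, map_add, add_smul, map_smul, smul_assoc]
    refine add_mem ?_ (Submodule.smul_mem _ _ (ι_smul_mem_ker_pow_smul hS p y hy'))
    rw [pow_succ_smul]
    refine Submodule.smul_mem_smul ⟨_, ?_, rfl⟩ hy'
    simp [hv]

end Generation

/-! ### Generic linear forms on finitely generated modules. -/

section AssociatedPrimes

variable {A M : Type*} [CommRing A] [AddCommGroup M] [Module A M]

/-- An element lying in all associated primes of `M` acts locally nilpotently on `M`. -/
theorem exists_pow_smul_eq_zero [IsNoetherianRing A] {x : A}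
    (hx : ∀ P ∈ associatedPrimes A M, x ∈ P) (y : M) :
    ∃ s : ℕ, x ^ s • y = 0 := by
  by_contra! hne
  let f : ℕ →o Ideal A :=
    { toFun := fun s => (⊥ : Submodule A M).colon {x ^ s • y}
      monotone' := monotone_nat_of_le_succ fun s c hc => by
        rw [Submodule.mem_colon_singleton, Submodule.mem_bot] at hc ⊢
        rw [pow_succ', mul_smul, smul_comm, hc, smul_zero] }
  -- Once the annihilators of x^s y are stable, x is injective on A x^s y; yet x lies in an
  -- associated prime of this nonzero module.
  obtain ⟨s, hs⟩ := monotone_stabilizes_iff_noetherian.2 ‹IsNoetherianRing A› f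
  let z : Submodule.span A {x ^ s • y} := ⟨x ^ s • y, Submodule.mem_span_singleton_self _⟩
  have hz : z ≠ 0 := fun h => hne s (congrArg Subtype.val h)
  obtain ⟨P, hP, -⟩ := exists_le_isAssociatedPrime_of_isNoetherianRing A z hz
  have hxP : x ∈ P := hx P
    (associatedPrimes.subset_of_injective (f := Submodule.subtype _) Subtype.val_injective hP)
  obtain ⟨hprime, ⟨w, hw⟩, rfl⟩ := isAssociatedPrime_iff.1 hP
  obtain ⟨c, rfl⟩ := Submodule.mem_span_singleton.1 hw
  rw [Submodule.mem_colon_singleton, Submodule.mem_bot] at hxP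
  have h1 : x • c • x ^ s • y = 0 := congrArg Subtype.val hxP
  have h2 : c ∈ f (s + 1) := by
    change c ∈ (⊥ : Submodule A M).colon {x ^ (s + 1) • y}
    rw [Submodule.mem_colon_singleton, Submodule.mem_bot, pow_succ', mul_smul, smul_comm, h1]
  rw [← hs (s + 1) (Nat.le_succ s)] at h2
  have h3 : c • x ^ s • y = 0 := by
    simpa [f, Submodule.mem_colon_singleton] using h2
  refine hprime.ne_top ((Ideal.eq_top_iff_one _).2 ?_)
  rw [Submodule.mem_colon_singleton, one_smul, Submodule.mem_bot]
  exact Subtype.ext h3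

variable {k : Type*} [Field k] [Algebra k A] [Module k M] [IsScalarTower k A M]

/-- A finitely generated module on which algebra generators act locally nilpotently is
finite-dimensional. -/
theorem finite_of_pow_smul_eq_zero [Module.Finite A M] {m : ℕ} {X : Fin m → A}
    (hX : Algebra.adjoin k (Set.range X) = ⊤) (h : ∀ j, ∀ y : M, ∃ s : ℕ, X j ^ s • y = 0) :
    Module.Finite k M := by
  let I := Module.annihilator A M
  have hnil : ∀ j, ∃ s : ℕ, X j ^ s ∈ I := by
    intro j
    obtain ⟨t, ht⟩ := (inferInstance : Module.Finite A M)
    choose s hs using h j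
    refine ⟨t.sup s, Module.mem_annihilator.2 fun y => ?_⟩
    have hy : y ∈ Submodule.span A (t : Set M) := ht ▸ Submodule.mem_top
    induction hy using Submodule.span_induction with
    | mem y hy =>
      rw [← Nat.sub_add_cancel (Finset.le_sup (f := s) hy), pow_add, mul_smul, hs, smul_zero]
    | zero => rw [smul_zero]
    | add y z _ _ hy hz => rw [smul_add, hy, hz, add_zero]
    | smul c y _ hy => rw [smul_comm, hy, smul_zero]
  let q := Ideal.Quotient.mkₐ k I
  have htop : Algebra.adjoin k (Set.range fun j => q (X j)) = ⊤ := by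
    have := AlgHom.map_adjoin q (Set.range X)
    rw [hX, Algebra.map_top, (AlgHom.range_eq_top q).2 (Ideal.Quotient.mkₐ_surjective k I),
      ← Set.range_comp] at this
    exact this.symm
  have hfin : Module.Finite k (A ⧸ I) := by
    rw [Module.finite_def, ← Algebra.top_toSubmodule, ← htop]
    refine fg_adjoin_of_finite (Set.finite_range _) ?_
    rintro _ ⟨j, rfl⟩
    obtain ⟨s, hs⟩ := hnil j
    -- The exponent s + 1 is used because `IsIntegral.of_pow` needs a positive exponent.
    have h0 : q (X j) ^ (s + 1) = 0 := by
      rw [pow_succ, ← map_pow]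
      rw [show q (X j ^ s) = 0 from Ideal.Quotient.eq_zero_iff_mem.2 hs, zero_mul]
    exact IsIntegral.of_pow (Nat.succ_pos s) (h0 ▸ isIntegral_zero)
  let _ : Module (A ⧸ I) M := Module.quotientAnnihilator
  have : IsScalarTower A (A ⧸ I) M := ⟨fun a b y => by
    obtain ⟨b, rfl⟩ := Ideal.Quotient.mk_surjective b
    change (a * b) • y = a • b • y
    rw [mul_smul]⟩
  have : IsScalarTower k (A ⧸ I) M := ⟨fun a b y => by
    obtain ⟨b, rfl⟩ := Ideal.Quotient.mk_surjective b
    change (a • b) • y = a • b • y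
    rw [smul_assoc]⟩
  have : Module.Finite (A ⧸ I) M := Module.Finite.of_restrictScalars_finite A (A ⧸ I) M
  exact Module.Finite.trans (A ⧸ I) M

/-- On a finitely generated module, a generic linear combination of algebra generators has
finite-dimensional kernel. -/
theorem exists_finite_ker_smul [IsNoetherianRing A] [Infinite k] [Module.Finite A M] {m : ℕ}
    {X : Fin m → A} (hX : Algebra.adjoin k (Set.range X) = ⊤) :
    ∃ a : Fin m → k, Module.Finite k (LinearMap.ker (LinearMap.lsmul A M (∑ j, a j • X j))) := by
  let e : (Fin m → k) →ₗ[k] A := Fintype.linearCombination k X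
  have he : ∀ a, e a = ∑ j, a j • X j := fun a => Fintype.linearCombination_apply k X a
  have hfin := associatedPrimes.finite A M
  classical
  -- The coefficient vector is chosen outside all proper subspaces W P, P an associated prime; over
  -- an infinite field finitely many of them do not cover.
  let W : Ideal A → Subspace k (Fin m → k) := fun P => (P.restrictScalars k).comap e
  let s := (hfin.toFinset.image W).erase ⊤
  have hs := Subspace.biUnion_ne_univ_of_top_notMem (s := s) (Finset.notMem_erase _ _)
  obtain ⟨a, ha⟩ := (Set.ne_univ_iff_exists_notMem _).1 hs
  refine ⟨a, ?_⟩
  set K := LinearMap.ker (LinearMap.lsmul A M (∑ j, a j • X j)) with hK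
  refine finite_of_pow_smul_eq_zero (A := A) hX fun j => exists_pow_smul_eq_zero fun P hP => ?_
  have hPM := associatedPrimes.subset_of_injective (f := K.subtype) Subtype.val_injective hP
  have haP : a ∈ W P := by
    obtain ⟨-, ⟨w, hw⟩, rfl⟩ := isAssociatedPrime_iff.1 hP
    change e a ∈ (⊥ : Submodule A K).colon {(⟨w, hw⟩ : K)}
    rw [Submodule.mem_colon_singleton, Submodule.mem_bot, he]
    exact Subtype.ext hw
  -- An associated prime of the kernel contains the chosen combination, so by that choice it
  -- contains every generator X j.
  have htop : W P = ⊤ := by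
    by_contra hne
    refine ha (Set.mem_biUnion (x := W P) ?_ haP)
    exact Finset.mem_erase.2 ⟨hne, Finset.mem_image_of_mem _ (hfin.mem_toFinset.2 hPM)⟩
  have : Pi.single j (1 : k) ∈ W P := htop ▸ Submodule.mem_top
  have h2 : e (Pi.single j 1) ∈ P := this
  rwa [Fintype.linearCombination_apply_single, one_smul] at h2

end AssociatedPrimes

/-! ### Commuting operators of degree one with bounded ranks. -/

section Pencil

variable {k : Type*} [Field k]

open scoped IsMulCommutative in
theorem exists_aeval_of_commute {M : Type*} [AddCommGroup M] [Module k M]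
    {m : ℕ} (Y : Fin m → Module.End k M) (hcomm : ∀ i j, Y i * Y j = Y j * Y i) :
    ∃ φ : MvPolynomial (Fin m) k →ₐ[k] Module.End k M, ∀ j, φ (MvPolynomial.X j) = Y j := by
  have : IsMulCommutative (Algebra.adjoin k (Set.range Y)) := by
    refine Algebra.isMulCommutative_adjoin k ?_
    rintro _ ⟨j, rfl⟩ _ ⟨l, rfl⟩
    exact hcomm j l
  refine ⟨(Subalgebra.val _).comp (MvPolynomial.aeval (R := k)
    (S₁ := Algebra.adjoin k (Set.range Y)) fun j => ⟨Y j, Algebra.subset_adjoin ⟨j, rfl⟩⟩),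
    fun j => ?_⟩
  rw [AlgHom.comp_apply, MvPolynomial.aeval_X]
  rfl

/-- For commuting operators generating a space from a finite set, a generic linear combination
has finite-dimensional kernel. -/
theorem exists_finite_ker_of_commute [Infinite k] {M : Type*} [AddCommGroup M] [Module k M]
    {m : ℕ} (Y : Fin m → Module.End k M) (hcomm : ∀ i j, Y i * Y j = Y j * Y i)
    (G : Set M) (hG : G.Finite)
    (hgen : ∀ N : Submodule k M, G ⊆ N → (∀ j, ∀ x ∈ N, Y j x ∈ N) → N = ⊤) :
    ∃ a : Fin m → k, Module.Finite k (LinearMap.ker (∑ j, a j • Y j)) := by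
  obtain ⟨φ, hφ⟩ := exists_aeval_of_commute Y hcomm
  let _ : Module (MvPolynomial (Fin m) k) M := Module.compHom M φ.toRingHom
  have hsmul : ∀ (p : MvPolynomial (Fin m) k) (x : M), p • x = φ p x := fun _ _ => rfl
  have : IsScalarTower k (MvPolynomial (Fin m) k) M := ⟨fun c p x => by
    rw [hsmul, hsmul, map_smul, LinearMap.smul_apply]⟩
  have : Module.Finite (MvPolynomial (Fin m) k) M := by
    refine ⟨⟨hG.toFinset, ?_⟩⟩
    rw [Set.Finite.coe_toFinset]
    have h := hgen ((Submodule.span (MvPolynomial (Fin m) k) G).restrictScalars k)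
      Submodule.subset_span fun j x hx => by
        rw [← hφ, ← hsmul]
        exact Submodule.smul_mem _ (MvPolynomial.X j) hx
    exact (Submodule.restrictScalars_eq_top_iff k _ _).1 h
  obtain ⟨a, ha⟩ := exists_finite_ker_smul (k := k) (M := M)
    (MvPolynomial.adjoin_range_X (R := k) (σ := Fin m))
  refine ⟨a, ?_⟩
  have e : LinearMap.ker (∑ j, a j • Y j) = (LinearMap.ker (LinearMap.lsmul
      (MvPolynomial (Fin m) k) M (∑ j, a j • MvPolynomial.X j))).restrictScalars k := by
    ext x
    rw [Submodule.restrictScalars_mem, LinearMap.mem_ker, LinearMap.mem_ker,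
      LinearMap.lsmul_apply, hsmul, map_sum]
    simp only [map_smul, hφ]
  rw [e]
  exact ha

/-! ### The graded module assembled from a pencil of matrices. -/

section GradedPencil

variable {m : ℕ} {b : ℕ → ℕ} (T : ∀ i, Fin m → ((Fin (b i) → k) →ₗ[k] (Fin (b (i + 1)) → k)))

/-- The operator of degree one on a direct sum with given components. -/
def shiftOperator (j : Fin m) : Module.End k (⨁ i, (Fin (b i) → k)) :=
  DirectSum.toModule k ℕ _ fun i =>
    (DirectSum.lof k ℕ (fun i => (Fin (b i) → k)) (i + 1)).comp (T i j)

theorem shiftOperator_lof (j : Fin m) (i : ℕ) (w : Fin (b i) → k) :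
    shiftOperator T j (DirectSum.lof k ℕ (fun i => (Fin (b i) → k)) i w) =
      DirectSum.lof k ℕ (fun i => (Fin (b i) → k)) (i + 1) (T i j w) := by
  rw [shiftOperator, DirectSum.toModule_lof]
  rfl

theorem sum_shiftOperator_lof (a : Fin m → k) (i : ℕ) (w : Fin (b i) → k) :
    (∑ j, a j • shiftOperator T j) (DirectSum.lof k ℕ (fun i => (Fin (b i) → k)) i w) =
      DirectSum.lof k ℕ (fun i => (Fin (b i) → k)) (i + 1) ((∑ j, a j • T i j) w) := by
  rw [LinearMap.sum_apply, LinearMap.sum_apply, map_sum]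
  refine Finset.sum_congr rfl fun j _ => ?_
  rw [LinearMap.smul_apply, LinearMap.smul_apply, map_smul, shiftOperator_lof]

theorem shiftOperator_comm
    (comm : ∀ i j l w, T (i + 1) j (T i l w) = T (i + 1) l (T i j w)) (j l : Fin m) :
    shiftOperator T j * shiftOperator T l = shiftOperator T l * shiftOperator T j := by
  refine DirectSum.linearMap_ext k fun i => LinearMap.ext fun w => ?_
  rw [LinearMap.comp_apply, LinearMap.comp_apply, Module.End.mul_apply, Module.End.mul_apply,
    shiftOperator_lof, shiftOperator_lof, shiftOperator_lof, shiftOperator_lof, comm]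

theorem eq_top_of_shiftOperator_mem (surj : ∀ i, ⨆ j, LinearMap.range (T i j) = ⊤)
    (N : Submodule k (⨁ i, (Fin (b i) → k)))
    (h0 : ∀ l, DirectSum.lof k ℕ (fun i => (Fin (b i) → k)) 0 (Pi.single l 1) ∈ N)
    (hN : ∀ j, ∀ x ∈ N, shiftOperator T j x ∈ N) : N = ⊤ := by
  have h : ∀ i w, DirectSum.lof k ℕ (fun i => (Fin (b i) → k)) i w ∈ N := by
    intro i
    induction i with
    | zero =>
      intro w
      rw [pi_eq_sum_univ' w, map_sum]
      refine sum_mem fun i _ => ?_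
      rw [map_smul]
      refine N.smul_mem _ ?_
      convert h0 i using 2
    | succ i ih =>
      intro w
      have hw : w ∈ ⨆ j, LinearMap.range (T i j) := surj i ▸ Submodule.mem_top
      refine Submodule.iSup_induction _ (motive := fun w =>
        DirectSum.lof k ℕ (fun i => (Fin (b i) → k)) (i + 1) w ∈ N) hw ?_ ?_ ?_
      · rintro j _ ⟨y, rfl⟩
        rw [← shiftOperator_lof]
        exact hN j _ (ih y)
      · rw [map_zero]; exact zero_mem _
      · intro x y hx hy
        rw [map_add]; exact add_mem hx hy
  refine Submodule.eq_top_iff'.2 fun x => ?_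
  induction x using DirectSum.induction_on with
  | zero => exact zero_mem _
  | of i x => exact h i x
  | add x y hx hy => exact add_mem hx hy

theorem exists_forall_apply_eq_zero (K : Submodule k (⨁ i, (Fin (b i) → k)))
    (hK : Module.Finite k K) : ∃ q, ∀ x ∈ K, ∀ p, q < p → x p = 0 := by
  classical
  obtain ⟨t, ht⟩ := (Submodule.fg_top K).1 (Module.Finite.fg_top (R := k) (M := K))
  refine ⟨t.sup fun x => (DFinsupp.support x).sup id, fun x hx p hp => ?_⟩
  rw [← ht] at hx
  refine Submodule.span_induction (p := fun y _ => y p = 0) (fun y hy => ?_) rfl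
    (fun y z _ _ hy hz => ?_) (fun c y _ hy => ?_) hx
  · by_contra hne
    have h1 : p ≤ (DFinsupp.support y).sup id :=
      Finset.le_sup (f := id) (DFinsupp.mem_support_iff.2 hne)
    have h2 := Finset.le_sup (f := fun x => (DFinsupp.support x).sup id) hy
    exact absurd (h1.trans h2) (not_le.2 hp)
  · rw [DirectSum.add_apply, hy, hz, add_zero]
  · rw [DirectSum.smul_apply, hy, smul_zero]

end GradedPencil

theorem exists_eventually_constant {g : ℕ → ℕ} {q c : ℕ} (hg : ∀ i, q < i → g i ≤ g (i + 1))
    (hc : ∀ i, g i ≤ c) : ∃ i₀, ∀ i ≥ i₀, g i = g (i + 1) := by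
  let f : ℕ →o ℕ := ⟨fun i => g (q + 1 + i), monotone_nat_of_le_succ fun i => hg _ (by omega)⟩
  have hb : BddAbove (Set.range f) := ⟨c, by rintro _ ⟨i, rfl⟩; exact hc _⟩
  obtain ⟨i₀, h⟩ := Nat.sSup_mem (Set.range_nonempty f) hb
  have hmax : ∀ i ≥ i₀, g (q + 1 + i) = g (q + 1 + i₀) := fun i hi =>
    le_antisymm ((le_csSup hb ⟨i, rfl⟩).trans_eq h.symm) (f.monotone hi)
  refine ⟨q + 1 + i₀, fun i hi => ?_⟩
  obtain ⟨l, rfl⟩ := Nat.exists_eq_add_of_le hi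
  have h1 := hmax (i₀ + l) (by omega)
  have h2 := hmax (i₀ + l + 1) (by omega)
  rw [← add_assoc] at h1 h2
  rw [← add_assoc] at h2
  rw [h1, h2]

/-- A generic member of a bounded pencil of commuting operators that jointly generate is
bijective in large degrees. -/
theorem exists_bijective_pencil [Infinite k] {m : ℕ} (b : ℕ → ℕ)
    (T : ∀ i, Fin m → ((Fin (b i) → k) →ₗ[k] (Fin (b (i + 1)) → k)))
    (comm : ∀ i j l w, T (i + 1) j (T i l w) = T (i + 1) l (T i j w))
    (surj : ∀ i, ⨆ j, LinearMap.range (T i j) = ⊤) (c : ℕ) (bdd : ∀ i, b i ≤ c) :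
    ∃ a : Fin m → k, ∃ i₀, ∀ i ≥ i₀, Function.Bijective
      (∑ j, a j • T i j : (Fin (b i) → k) →ₗ[k] (Fin (b (i + 1)) → k)) := by
  obtain ⟨a, ha⟩ := exists_finite_ker_of_commute (shiftOperator T) (shiftOperator_comm T comm)
    (Set.range fun l => DirectSum.lof k ℕ (fun i => (Fin (b i) → k)) 0 (Pi.single l 1))
    (Set.finite_range _)
    (fun N hG hN => eq_top_of_shiftOperator_mem T surj N (fun l => hG ⟨l, rfl⟩) hN)
  obtain ⟨q, hq⟩ := exists_forall_apply_eq_zero _ ha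
  have hinj : ∀ i, q < i → Function.Injective
      (∑ j, a j • T i j : (Fin (b i) → k) →ₗ[k] (Fin (b (i + 1)) → k)) := by
    -- A kernel vector in degree i is a kernel element of the total operator, and these vanish in
    -- degrees above q.
    intro i hi
    rw [injective_iff_map_eq_zero]
    intro w hw
    have h2 := hq (DirectSum.lof k ℕ (fun i => (Fin (b i) → k)) i w)
      (by rw [LinearMap.mem_ker, sum_shiftOperator_lof, hw, map_zero]) i hi
    rwa [DirectSum.lof_apply] at h2
  obtain ⟨i₀, hi₀⟩ := exists_eventually_constant (g := b) (q := q) (c := c) (fun i hi => by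
    simpa using LinearMap.finrank_le_finrank_of_injective (hinj i hi)) bdd
  refine ⟨a, max i₀ (q + 1), fun i hi => ?_⟩
  have h := hinj i (by have := le_max_right i₀ (q + 1); omega)
  refine ⟨h, (LinearMap.injective_iff_surjective_of_finrank_eq_finrank ?_).1 h⟩
  simpa using hi₀ i ((le_max_left _ _).trans hi)

end Pencil

/-! ### Nakayama's lemma and minimal covers. -/

section Nakayama

variable {k V : Type*} [Field k] [AddCommGroup V] [Module k V]

theorem sub_algebraMapInv_mem (r : ExteriorAlgebra k V) :
    r - algebraMap k _ (algebraMapInv r) ∈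
      (LinearMap.range (ι k : V →ₗ[k] ExteriorAlgebra k V)) •
        (⊤ : Submodule k (ExteriorAlgebra k V)) := by
  have hmul : ∀ x ∈ (LinearMap.range (ι k : V →ₗ[k] ExteriorAlgebra k V)) •
      (⊤ : Submodule k (ExteriorAlgebra k V)), ∀ y, x * y ∈
        (LinearMap.range (ι k : V →ₗ[k] ExteriorAlgebra k V)) •
          (⊤ : Submodule k (ExteriorAlgebra k V)) := by
    intro x hx y
    refine Submodule.smul_induction_on hx (fun u hu w _ => ?_) fun x z hx hz => ?_
    · rw [smul_mul_assoc]
      exact Submodule.smul_mem_smul hu Submodule.mem_top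
    · rw [add_mul]
      exact add_mem hx hz
  induction r using ExteriorAlgebra.induction with
  | algebraMap c => simp
  | ι v =>
    rw [algebraMapInv, lift_ι_apply, LinearMap.zero_apply, map_zero, sub_zero,
      ← mul_one (ι k v), ← smul_eq_mul]
    exact Submodule.smul_mem_smul (LinearMap.mem_range_self _ _) Submodule.mem_top
  | mul a b ha hb =>
    have e : a * b - algebraMap k _ (algebraMapInv (a * b)) =
        (a - algebraMap k _ (algebraMapInv a)) * b +
          algebraMapInv a • (b - algebraMap k _ (algebraMapInv b)) := by
      rw [map_mul, map_mul, Algebra.smul_def]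
      noncomm_ring
    rw [e]
    exact add_mem (hmul _ ha _) (Submodule.smul_mem _ _ hb)
  | add a b ha hb =>
    rw [map_add, map_add, add_sub_add_comm]
    exact add_mem ha hb

/-- The iteration behind Nakayama's lemma: substituting the decomposition of the whole module into
itself raises the power of I, which later is nilpotent. -/
theorem sup_pow_smul_top_eq_top {Q : Type*} [AddCommGroup Q] [Module k Q]
    [Module (ExteriorAlgebra k V) Q] [IsScalarTower k (ExteriorAlgebra k V) Q]
    (N : Submodule k Q) (I : Submodule k (ExteriorAlgebra k V)) (hN : I • N ≤ N)
    (h : N ⊔ I • ⊤ = ⊤) (p : ℕ) : N ⊔ I ^ p • ⊤ = ⊤ := by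
  induction p with
  | zero => rw [pow_zero, Submodule.one_smul, sup_top_eq]
  | succ p ih =>
    refine eq_top_iff.2 (h.ge.trans (sup_le le_sup_left ?_))
    rw [pow_succ_smul]
    calc I • ⊤ = I • (N ⊔ I ^ p • ⊤) := by rw [ih]
      _ = I • N ⊔ I • I ^ p • ⊤ := Submodule.smul_sup _ _ _
      _ ≤ N ⊔ I • I ^ p • ⊤ := sup_le_sup_right hN _

/-- Nakayama's lemma for free modules over the exterior algebra. -/
theorem eq_top_of_forall_exists_sub [FiniteDimensional k V] {b : ℕ}
    (N : Submodule (ExteriorAlgebra k V) (Fin b → ExteriorAlgebra k V))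
    (h : ∀ y, ∃ z ∈ N, ∀ a, algebraMapInv ((y - z) a) = 0) : N = ⊤ := by
  let P := LinearMap.range (ι k : V →ₗ[k] ExteriorAlgebra k V)
  let N' := N.restrictScalars k
  have hsup : N' ⊔ P • (⊤ : Submodule k (Fin b → ExteriorAlgebra k V)) = ⊤ := by
    refine Submodule.eq_top_iff'.2 fun y => ?_
    obtain ⟨z, hz, hyz⟩ := h y
    rw [← add_sub_cancel z y]
    refine Submodule.add_mem_sup hz ?_
    rw [← Finset.univ_sum_single (y - z)]
    refine sum_mem fun a _ => ?_
    have h1 := sub_algebraMapInv_mem ((y - z) a)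
    rw [hyz, map_zero, sub_zero] at h1
    generalize (y - z) a = r at h1
    refine Submodule.smul_induction_on h1 (fun u hu w _ => ?_) fun r s hr hs => ?_
    · rw [Pi.single_smul]
      exact Submodule.smul_mem_smul hu Submodule.mem_top
    · rw [Pi.single_add]
      exact add_mem hr hs
  have hpow := sup_pow_smul_top_eq_top N' P
    (Submodule.smul_le.2 fun r _ n hn => N.smul_mem r hn) hsup
  have h0 := hpow (Module.finrank k V + 1)
  rw [show P ^ (Module.finrank k V + 1) = ⊥ from exteriorPower_eq_bot (Nat.lt_succ_self _),
    Submodule.bot_smul, sup_bot_eq] at h0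
  exact (Submodule.restrictScalars_eq_top_iff k _ _).1 h0

variable {Y Z : Type*} [AddCommGroup Y] [Module (ExteriorAlgebra k V) Y]
  [AddCommGroup Z] [Module (ExteriorAlgebra k V) Z]

/-- Projectivity gives the lift. It is onto modulo ker q, which lies in the radical, so it is onto
by Nakayama. -/
theorem exists_surjective_lift [FiniteDimensional k V] {a b : ℕ}
    (p : (Fin a → ExteriorAlgebra k V) →ₗ[ExteriorAlgebra k V] Y)
    (q : (Fin b → ExteriorAlgebra k V) →ₗ[ExteriorAlgebra k V] Z)
    (hp : Function.Surjective p) (hq : Function.Surjective q)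
    (hker : ∀ x, q x = 0 → ∀ i, algebraMapInv (x i) = 0) (e : Y ≃ₗ[ExteriorAlgebra k V] Z) :
    ∃ f : (Fin a → ExteriorAlgebra k V) →ₗ[ExteriorAlgebra k V] (Fin b → ExteriorAlgebra k V),
      (∀ x, q (f x) = e (p x)) ∧ Function.Surjective f := by
  obtain ⟨f, hf⟩ := Module.projective_lifting_property q (e.toLinearMap ∘ₗ p) hq
  have hf' : ∀ x, q (f x) = e (p x) := fun x => LinearMap.congr_fun hf x
  refine ⟨f, hf', LinearMap.range_eq_top.1 (eq_top_of_forall_exists_sub _ fun y => ?_)⟩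
  obtain ⟨x, hx⟩ := hp (e.symm (q y))
  refine ⟨f x, LinearMap.mem_range_self _ _, hker _ ?_⟩
  rw [map_sub, hf', hx, e.apply_symm_apply, sub_self]

theorem finrank_fun_exteriorAlgebra [FiniteDimensional k V] (a : ℕ) :
    Module.finrank k (Fin a → ExteriorAlgebra k V) =
      a * Module.finrank k (ExteriorAlgebra k V) := by
  rw [Module.finrank_pi_fintype]
  simp

/-- Minimal free covers of isomorphic modules are isomorphic. -/
theorem exists_cover_equiv [FiniteDimensional k V] {a b : ℕ}
    (p : (Fin a → ExteriorAlgebra k V) →ₗ[ExteriorAlgebra k V] Y)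
    (q : (Fin b → ExteriorAlgebra k V) →ₗ[ExteriorAlgebra k V] Z)
    (hp : Function.Surjective p) (hq : Function.Surjective q)
    (hkp : ∀ x, p x = 0 → ∀ i, algebraMapInv (x i) = 0)
    (hkq : ∀ x, q x = 0 → ∀ i, algebraMapInv (x i) = 0) (e : Y ≃ₗ[ExteriorAlgebra k V] Z) :
    a = b ∧ ∃ f : (Fin a → ExteriorAlgebra k V) ≃ₗ[ExteriorAlgebra k V]
      (Fin b → ExteriorAlgebra k V), ∀ x, q (f x) = e (p x) := by
  obtain ⟨f, hf, hfs⟩ := exists_surjective_lift p q hp hq hkq e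
  obtain ⟨g, -, hgs⟩ := exists_surjective_lift q p hq hp hkp e.symm
  have h1 := LinearMap.finrank_le_finrank_of_surjective (f := f.restrictScalars k) hfs
  have h2 := LinearMap.finrank_le_finrank_of_surjective (f := g.restrictScalars k) hgs
  -- Surjections in both directions force equal finite dimensions.
  have hfi : Function.Injective (f.restrictScalars k) :=
    (LinearMap.injective_iff_surjective_of_finrank_eq_finrank (le_antisymm h2 h1)).2 hfs
  refine ⟨?_, LinearEquiv.ofBijective f ⟨hfi, hfs⟩, hf⟩
  rw [finrank_fun_exteriorAlgebra, finrank_fun_exteriorAlgebra] at h1 h2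
  exact le_antisymm (Nat.le_of_mul_le_mul_right h2 Module.finrank_pos)
    (Nat.le_of_mul_le_mul_right h1 Module.finrank_pos)

end Nakayama

/-! ### Betti numbers and complexity one. -/

section Ranks

variable {k V X : Type*} [Field k] [AddCommGroup V] [Module k V]
  [AddCommGroup X] [Module k X] [Module (ExteriorAlgebra k V) X]
  [IsScalarTower k (ExteriorAlgebra k V) X] {𝒳 : ℤ → Submodule k X}

namespace GradedFreeResolution

theorem IsMinimal.algebraMapInv_eq_zero {F : GradedFreeResolution V 𝒳} (hF : F.IsMinimal)
    {i : ℕ} {x : Fin (F.rank (i + 1)) → ExteriorAlgebra k V} (hx : F.d i x = 0)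
    (a : Fin (F.rank (i + 1))) : algebraMapInv (x a) = 0 := by
  obtain ⟨y, rfl⟩ := (F.exact_d i x).1 hx
  exact hF (i + 1) y a

/-- The ranks in two minimal resolutions of the same module agree. -/
theorem rank_eq_rank [FiniteDimensional k V] {F G : GradedFreeResolution V 𝒳}
    (hF : F.IsMinimal) (hG : G.IsMinimal) (i : ℕ) : F.rank i = G.rank i := by
  -- Equal ranks alone do not propagate; the induction also carries an isomorphism that matches the
  -- syzygies.
  suffices h : F.rank i = G.rank i ∧
      ∃ f : (Fin (F.rank i) → ExteriorAlgebra k V) ≃ₗ[ExteriorAlgebra k V]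
        (Fin (G.rank i) → ExteriorAlgebra k V),
        (LinearMap.range (F.d i)).map f.toLinearMap = LinearMap.range (G.d i) from h.1
  induction i with
  | zero =>
    obtain ⟨h, f, hf⟩ := exists_cover_equiv F.aug G.aug F.aug_surjective G.aug_surjective
      (fun x hx => by obtain ⟨y, rfl⟩ := (F.exact_aug x).1 hx; exact hF 0 y)
      (fun x hx => by obtain ⟨y, rfl⟩ := (G.exact_aug x).1 hx; exact hG 0 y)
      (LinearEquiv.refl _ _)
    refine ⟨h, f, ?_⟩
    ext y
    rw [Submodule.mem_map_equiv, LinearMap.mem_range, LinearMap.mem_range]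
    change f.symm y ∈ Set.range (F.d 0) ↔ y ∈ Set.range (G.d 0)
    rw [← F.exact_aug, ← G.exact_aug, ← f.apply_symm_apply y, hf, f.symm_apply_apply]
    rfl
  | succ i ih =>
    obtain ⟨-, g, hg⟩ := ih
    let e := (g.submoduleMap (LinearMap.range (F.d i))).trans (LinearEquiv.ofEq _ _ hg)
    obtain ⟨h, f, hf⟩ := exists_cover_equiv (F.d i).rangeRestrict (G.d i).rangeRestrict
      (F.d i).surjective_rangeRestrict (G.d i).surjective_rangeRestrict
      (fun x hx => hF.algebraMapInv_eq_zero (congrArg Subtype.val hx))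
      (fun x hx => hG.algebraMapInv_eq_zero (congrArg Subtype.val hx)) e
    refine ⟨h, f, ?_⟩
    ext y
    rw [Submodule.mem_map_equiv, LinearMap.mem_range, LinearMap.mem_range]
    change f.symm y ∈ Set.range (F.d (i + 1)) ↔ y ∈ Set.range (G.d (i + 1))
    have h1 : F.d i (f.symm y) = 0 ↔ (F.d i).rangeRestrict (f.symm y) = 0 := by
      rw [Subtype.ext_iff]; rfl
    have h2 : G.d i y = 0 ↔ (G.d i).rangeRestrict y = 0 := by
      rw [Subtype.ext_iff]; rfl
    have h3 := hf (f.symm y)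
    rw [f.apply_symm_apply] at h3
    rw [← F.exact_d, ← G.exact_d, h1, h2, h3, LinearEquiv.map_eq_zero_iff]

end GradedFreeResolution

/-- Complexity is witnessed by some minimal resolution; uniqueness of the ranks transfers its bound
to the given one. -/
theorem exists_rank_le_of_complexity_eq_one [FiniteDimensional k V]
    (hcx : complexity V 𝒳 = 1) {F : GradedFreeResolution V 𝒳} (hF : F.IsMinimal) :
    ∃ c : ℕ, ∀ i, F.rank i ≤ c := by
  set s := {m : ℕ | ∃ F : GradedFreeResolution V 𝒳, F.IsMinimal ∧
    ∃ c : ℚ, 0 < c ∧ ∀ i : ℕ, 1 ≤ i → (F.rank i : ℚ) ≤ c * (i : ℚ) ^ ((m : ℤ) - 1)} with hs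
  have h1 : (⨅ m ∈ s, (m : ℕ∞)) = 1 := hcx
  have hmem : ∃ m ∈ s, m ≤ 1 := by
    by_contra! hne
    have : (2 : ℕ∞) ≤ ⨅ m ∈ s, (m : ℕ∞) :=
      le_iInf₂ fun m hm => by exact_mod_cast hne m hm
    rw [h1] at this
    exact absurd this (by decide)
  obtain ⟨m, ⟨G, hG, c, hc, hGc⟩, hm⟩ := hmem
  -- The growth estimate says nothing at i = 0, so that rank enters separately.
  refine ⟨max (F.rank 0) ⌈c⌉₊, fun i => ?_⟩
  rcases Nat.eq_zero_or_pos i with rfl | hi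
  · exact le_max_left _ _
  refine le_trans ?_ (le_max_right _ _)
  rw [GradedFreeResolution.rank_eq_rank hF hG]
  have h2 := (hGc i hi).trans ((mul_le_of_le_one_right hc.le ?_).trans (Nat.le_ceil c))
  · exact_mod_cast h2
  · refine zpow_le_one_of_nonpos₀ ?_ ?_
    · exact_mod_cast hi
    · have : (m : ℤ) ≤ 1 := by exact_mod_cast hm
      linarith

theorem exists_rank_ne_zero_of_complexity_eq_one
    (hcx : complexity V 𝒳 = 1) {F : GradedFreeResolution V 𝒳} (hF : F.IsMinimal) :
    ∃ i, 1 ≤ i ∧ F.rank i ≠ 0 := by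
  by_contra! h
  have h0 : complexity V 𝒳 ≤ ((0 : ℕ) : ℕ∞) := by
    refine iInf₂_le 0 ⟨F, hF, 1, one_pos, fun i hi => ?_⟩
    rw [h i hi, Nat.cast_zero]
    positivity
  rw [hcx] at h0
  exact absurd h0 (by decide)

end Ranks

/-! ### Matrices of vectors and their evaluation at linear forms. -/

section LinearMaps

variable {k V : Type*} [Field k] [AddCommGroup V] [Module k V]

/-- The map of free modules over the exterior algebra given by a matrix of vectors. -/
def linearMatrixMap (k : Type*) {V : Type*} [Field k] [AddCommGroup V] [Module k V]
    {a b : ℕ} (D : Fin a → Fin b → V) :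
    (Fin a → ExteriorAlgebra k V) →ₗ[ExteriorAlgebra k V] (Fin b → ExteriorAlgebra k V) where
  toFun z c := ∑ i, z i * ι k (D i c)
  map_add' z w := by
    ext c
    simp [add_mul, Finset.sum_add_distrib]
  map_smul' r z := by
    ext c
    simp [mul_assoc, Finset.mul_sum]

theorem linearMatrixMap_apply {a b : ℕ} (D : Fin a → Fin b → V)
    (z : Fin a → ExteriorAlgebra k V) (c : Fin b) :
    linearMatrixMap k D z c = ∑ i, z i * ι k (D i c) := rfl

theorem linearMatrixMap_algebraMap {a b : ℕ} (D : Fin a → Fin b → V) (z : Fin a → k) (c : Fin b) :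
    linearMatrixMap k D (fun i => algebraMap k _ (z i)) c = ι k (∑ i, z i • D i c) := by
  rw [linearMatrixMap_apply, map_sum]
  simp [Algebra.smul_def]

/-- The matrix obtained by evaluating a linear form. -/
def evalMatrix {a b : ℕ} (l : Module.Dual k V) (D : Fin a → Fin b → V) : Matrix (Fin a) (Fin b) k :=
  Matrix.of fun i c => l (D i c)

theorem vecMul_evalMatrix {a b : ℕ} (l : Module.Dual k V) (D : Fin a → Fin b → V) (z : Fin a → k)
    (c : Fin b) : Matrix.vecMul z (evalMatrix l D) c = l (∑ i, z i • D i c) := by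
  simp [Matrix.vecMul, dotProduct, evalMatrix]

/-- The matrix entries have degree one, so the degree p component of any preimage already works. -/
theorem exists_homogeneous_preimage {a b : ℕ} {D : Fin a → Fin b → V} {p : ℕ}
    {z : Fin a → ExteriorAlgebra k V} {y : Fin b → ExteriorAlgebra k V}
    (hy : ∀ c, y c ∈ ⋀[k]^(p + 1) V) (hz : linearMatrixMap k D z = y) :
    ∃ w : Fin a → ExteriorAlgebra k V, (∀ i, w i ∈ ⋀[k]^p V) ∧ linearMatrixMap k D w = y := by
  let 𝒜 : ℕ → Submodule k (ExteriorAlgebra k V) := fun i => ⋀[k]^i V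
  refine ⟨fun i => DirectSum.decompose 𝒜 (z i) p, fun i => SetLike.coe_mem _, ?_⟩
  ext c
  have h1 : ∀ i, (DirectSum.decompose 𝒜 (z i) p : ExteriorAlgebra k V) * ι k (D i c) =
      DirectSum.decompose 𝒜 (z i * ι k (D i c)) (p + 1) := fun i =>
    (DirectSum.coe_decompose_mul_add_of_right_mem 𝒜 (ι_mem_exteriorPower_one (D i c))).symm
  have h2 : (DirectSum.decompose 𝒜 (y c) (p + 1) : ExteriorAlgebra k V) = y c :=
    DirectSum.decompose_of_mem_same 𝒜 (hy c)
  rw [linearMatrixMap_apply, ← h2, ← hz, linearMatrixMap_apply, DirectSum.decompose_sum,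
    DFinsupp.finsetSum_apply, AddSubmonoidClass.coe_finsetSum]
  exact Finset.sum_congr rfl fun i _ => h1 i

variable {Q : Type*} [AddCommGroup Q] [Module k Q] [Module (ExteriorAlgebra k V) Q]
  [IsScalarTower k (ExteriorAlgebra k V) Q] {b : ℕ}

omit [Module k Q] [IsScalarTower k (ExteriorAlgebra k V) Q] in
theorem apply_eq_sum_smul (π : (Fin b → ExteriorAlgebra k V) →ₗ[ExteriorAlgebra k V] Q)
    (z : Fin b → ExteriorAlgebra k V) : π z = ∑ c, z c • π (Pi.single c 1) := by
  conv_lhs => rw [pi_eq_sum_univ' z, map_sum]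
  refine Finset.sum_congr rfl fun c _ => ?_
  rw [map_smul]

/-- The span of the images of the basis vectors. -/
def basisSpan (π : (Fin b → ExteriorAlgebra k V) →ₗ[ExteriorAlgebra k V] Q) : Submodule k Q :=
  Submodule.span k (Set.range fun c => π (Pi.single c 1))

omit [IsScalarTower k (ExteriorAlgebra k V) Q] in
theorem apply_single_mem_basisSpan
    (π : (Fin b → ExteriorAlgebra k V) →ₗ[ExteriorAlgebra k V] Q) (c : Fin b) :
    π (Pi.single c 1) ∈ basisSpan π :=
  Submodule.subset_span ⟨c, rfl⟩

theorem apply_mem_smul_basisSpan (π : (Fin b → ExteriorAlgebra k V) →ₗ[ExteriorAlgebra k V] Q)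
    {I : Submodule k (ExteriorAlgebra k V)} {z : Fin b → ExteriorAlgebra k V}
    (hz : ∀ c, z c ∈ I) : π z ∈ I • basisSpan π := by
  rw [apply_eq_sum_smul]
  exact sum_mem fun c _ => Submodule.smul_mem_smul (hz c) (apply_single_mem_basisSpan π c)

theorem exists_of_mem_smul_basisSpan
    (π : (Fin b → ExteriorAlgebra k V) →ₗ[ExteriorAlgebra k V] Q)
    {I : Submodule k (ExteriorAlgebra k V)} {x : Q} (hx : x ∈ I • basisSpan π) :
    ∃ z : Fin b → ExteriorAlgebra k V, (∀ c, z c ∈ I) ∧ π z = x := by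
  refine Submodule.smul_induction_on hx (fun r hr y hy => ?_) ?_
  · refine Submodule.span_induction (p := fun y _ => ∃ z : Fin b → ExteriorAlgebra k V,
      (∀ c, z c ∈ I) ∧ π z = r • y) ?_ ?_ ?_ ?_ hy
    · rintro _ ⟨c, rfl⟩
      refine ⟨r • Pi.single c 1, fun c' => ?_, map_smul _ _ _⟩
      rw [Pi.smul_apply, Pi.single_apply]
      split_ifs
      · rwa [smul_eq_mul, mul_one]
      · rw [smul_zero]; exact zero_mem _
    · exact ⟨0, fun _ => zero_mem _, by rw [map_zero, smul_zero]⟩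
    · rintro x y _ _ ⟨z, hz, hz'⟩ ⟨w, hw, hw'⟩
      exact ⟨z + w, fun c => add_mem (hz c) (hw c), by rw [map_add, hz', hw', smul_add]⟩
    · rintro c x _ ⟨z, hz, hz'⟩
      refine ⟨c • z, fun c' => Submodule.smul_mem _ _ (hz c'), ?_⟩
      rw [LinearMap.map_smul_of_tower, hz', smul_algebra_smul_comm]
  · rintro x y ⟨z, hz, rfl⟩ ⟨w, hw, rfl⟩
    exact ⟨z + w, fun c => add_mem (hz c) (hw c), map_add _ _ _⟩

/-- The degree `p` part of a quotient of a free module is generated by the hyperplane `ker l`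
if in degree one it is. -/
theorem exists_ker_pow_apply_eq (π : (Fin b → ExteriorAlgebra k V) →ₗ[ExteriorAlgebra k V] Q)
    {l : Module.Dual k V} {v : V} (hv : l v = 1)
    (h : ∀ x ∈ basisSpan π, ι k v • x ∈ (LinearMap.ker l).map (ι k) • basisSpan π) {p : ℕ}
    {z : Fin b → ExteriorAlgebra k V} (hz : ∀ c, z c ∈ ⋀[k]^p V) :
    ∃ η : Fin b → ExteriorAlgebra k V,
      (∀ c, η c ∈ ((LinearMap.ker l).map (ι k)) ^ p) ∧ π η = π z :=
  exists_of_mem_smul_basisSpan π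
    (exteriorPower_smul_le hv h p (apply_mem_smul_basisSpan π hz))

/-- If the scalar row z satisfies z l(D) = e_c, then v e_c − zD has all entries in ker l, and zD is
zero in the quotient. So v times a generator can be rewritten with hyperplane vectors. -/
theorem smul_mem_of_vecMul_surjective {a : ℕ} {D : Fin a → Fin b → V}
    (π : (Fin b → ExteriorAlgebra k V) →ₗ[ExteriorAlgebra k V] Q)
    (hπ : ∀ z, π (linearMatrixMap k D z) = 0) {l : Module.Dual k V} {v : V} (hv : l v = 1)
    (hs : Function.Surjective fun z => Matrix.vecMul z (evalMatrix l D)) :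
    ∀ x ∈ basisSpan π, ι k v • x ∈ (LinearMap.ker l).map (ι k) • basisSpan π := by
  intro x hx
  refine Submodule.span_induction (p := fun x _ =>
    ι k v • x ∈ (LinearMap.ker l).map (ι k) • basisSpan π) ?_ ?_ ?_ ?_ hx
  · rintro _ ⟨c, rfl⟩
    obtain ⟨z, hz⟩ := hs (Pi.single c 1)
    have h0 := hπ fun i => algebraMap k _ (z i)
    have e : ι k v • π (Pi.single c 1) = π (fun c' =>
        ι k ((Pi.single c (1 : k) : Fin b → k) c' • v - ∑ i, z i • D i c')) := by
      rw [← sub_zero (ι k v • π _), ← h0, ← map_smul, ← map_sub]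
      congr 1
      ext c'
      rw [Pi.sub_apply, linearMatrixMap_algebraMap, map_sub, map_smul, Pi.smul_apply]
      congr 1
      by_cases hc : c' = c
      · subst hc; simp
      · simp [Pi.single_eq_of_ne hc]
    change ι k v • π (Pi.single c 1) ∈ _
    rw [e]
    refine apply_mem_smul_basisSpan π fun c' => ⟨_, ?_, rfl⟩
    rw [SetLike.mem_coe, LinearMap.mem_ker, map_sub, ← vecMul_evalMatrix]
    have := congrFun hz c'
    simp only at this
    rw [this, map_smul, hv, smul_eq_mul, mul_one, sub_self]
  · rw [smul_zero]; exact zero_mem _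
  · intro x y _ _ hx hy
    rw [smul_add]; exact add_mem hx hy
  · intro c x _ hx
    rw [smul_algebra_smul_comm]
    exact Submodule.smul_mem _ _ hx

end LinearMaps

/-! ### Descending one step along the resolution. -/

section TopElements

variable {k V : Type*} [Field k] [AddCommGroup V] [Module k V]

/-- `Ω` is a generator of the top exterior power and `ω` is a volume form of the hyperplane
`ker l`. -/
structure IsTopPair (l : Module.Dual k V) (n : ℕ) (Ω ω : ExteriorAlgebra k V) : Prop where
  ne_zero : Ω ≠ 0
  top_mem : Ω ∈ ⋀[k]^(n + 1) V
  mem : ω ∈ ⋀[k]^n V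
  top_mul : ∀ u, Ω * ι k u = 0
  ι_mul : ∀ u, ι k u * ω = l u • Ω
  mul_ι : ∀ u, ω * ι k u = ((-1) ^ n * l u) • Ω
  exists_smul : ∀ η ∈ ((LinearMap.ker l).map (ι k)) ^ n, ∃ c : k, η = c • ω

theorem isTopPair_contract {n : ℕ} (hV : Module.finrank k V = n + 1) {l : Module.Dual k V} {v : V}
    (hv : l v = 1) {Ω : ExteriorAlgebra k V} (hΩ : Ω ∈ ⋀[k]^(n + 1) V) (h0 : Ω ≠ 0)
    (hspan : ∀ r ∈ ⋀[k]^(n + 1) V, ∃ c : k, r = c • Ω) : IsTopPair l n Ω (contract l Ω) := by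
  have : FiniteDimensional k V := Module.finite_of_finrank_pos (by omega)
  have hι : ∀ u, ι k u * Ω = 0 := fun u => by
    have h1 := ι_mul_mem u hΩ
    rwa [exteriorPower_eq_bot (by omega), Submodule.mem_bot] at h1
  have hιω : ∀ u, ι k u * contract l Ω = l u • Ω := fun u => by
    have h1 := contract_ι_mul l u Ω
    rw [hι, map_zero] at h1
    exact (sub_eq_zero.1 h1.symm).symm
  refine ⟨h0, hΩ, contract_mem l hΩ, fun u => ?_, hιω, fun u => ?_, fun η hη => ?_⟩
  · rw [ι_mul_comm_of_mem u hΩ, hι, smul_zero]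
  · rw [ι_mul_comm_of_mem u (contract_mem l hΩ), hιω, smul_smul]
  · obtain ⟨c, hc⟩ := hspan _ (ι_mul_mem v (ker_pow_le l n hη))
    have h1 := contract_ι_mul l v η
    rw [hc, contract_eq_zero_of_mem_ker_pow l hη, hv, one_smul, mul_zero, sub_zero, map_smul] at h1
    exact ⟨c, h1.symm⟩

variable {l : Module.Dual k V} {n : ℕ} {Ω ω : ExteriorAlgebra k V} {a b : ℕ}

theorem linearMatrixMap_smul_top (h : IsTopPair l n Ω ω) (D : Fin a → Fin b → V) (z : Fin a → k) :
    linearMatrixMap k D (fun i => z i • ω) =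
      fun c => ((-1) ^ n * Matrix.vecMul z (evalMatrix l D) c) • Ω := by
  ext c
  rw [linearMatrixMap_apply]
  simp only [smul_mul_assoc, h.mul_ι, vecMul_evalMatrix, map_sum, map_smul, smul_eq_mul]
  rw [Finset.mul_sum, Finset.sum_smul]
  exact Finset.sum_congr rfl fun i _ => by rw [smul_smul]; ring_nf

theorem eq_zero_of_linearMatrixMap_smul_top_eq_zero (h : IsTopPair l n Ω ω)
    {D : Fin a → Fin b → V} {z : Fin a → k}
    (hz : linearMatrixMap k D (fun i => z i • ω) = 0) :
    Matrix.vecMul z (evalMatrix l D) = 0 := by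
  ext c
  have := congrFun hz c
  rw [linearMatrixMap_smul_top h] at this
  simpa [h.ne_zero] using this

variable {a' : ℕ} {D' : Fin a' → Fin a → V} {D : Fin a → Fin b → V}

/-- A preimage of Ω e_c under D can be taken with entries in ⋀^n H, that is of the form y ω with y a
scalar row. Up to sign D sends it to (y l(D)) Ω, so y l(D) = ± e_c. -/
theorem vecMul_surjective_of_top (h : IsTopPair l n Ω ω) {v : V} (hv : l v = 1)
    (hcomp : ∀ z, linearMatrixMap k D (linearMatrixMap k D' z) = 0)
    (hs : Function.Surjective fun z => Matrix.vecMul z (evalMatrix l D'))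
    (htop : ∀ c, ∃ z, linearMatrixMap k D z = Pi.single c Ω) :
    Function.Surjective fun z => Matrix.vecMul z (evalMatrix l D) := by
  change Function.Surjective (Matrix.vecMulLinear (evalMatrix l D))
  rw [← LinearMap.range_eq_top, eq_top_iff, ← (Pi.basisFun k (Fin b)).span_eq, Submodule.span_le]
  rintro _ ⟨c, rfl⟩
  obtain ⟨z, hz⟩ := htop c
  obtain ⟨w, hw, hw'⟩ := exists_homogeneous_preimage (p := n) (fun c' => by
    rw [Pi.single_apply]
    split_ifs
    · exact h.top_mem
    · exact zero_mem _) hz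
  obtain ⟨η, hη, hη'⟩ := exists_ker_pow_apply_eq (linearMatrixMap k D) hv
    (smul_mem_of_vecMul_surjective _ hcomp hv hs) hw
  choose y hy using fun i => h.exists_smul (η i) (hη i)
  -- The sign cancels the one from moving a vector past ω, which has degree n.
  refine ⟨(-1 : k) ^ n • y, ?_⟩
  rw [map_smul, Matrix.vecMulLinear_apply]
  ext c'
  have h1 : linearMatrixMap k D η c' = (Pi.single c Ω : Fin b → ExteriorAlgebra k V) c' := by
    rw [hη', hw']
  rw [show η = fun i => y i • ω from funext hy, linearMatrixMap_smul_top h] at h1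
  rw [Pi.basisFun_apply, Pi.smul_apply, smul_eq_mul]
  by_cases hc : c' = c
  · subst hc
    rw [Pi.single_eq_same] at h1 ⊢
    exact smul_left_injective k h.ne_zero (h1.trans (one_smul k Ω).symm)
  · rw [Pi.single_eq_of_ne hc] at h1 ⊢
    exact (smul_eq_zero.1 h1).resolve_right h.ne_zero

/-- Replace the preimage by η with entries in ⋀^{n-1} H. For u in H the entries of u η are multiples
of ω, and D(u η) = u y ω = 0, so u η = 0 by injectivity of l(D). Since n − 1 < dim H, this forces η
= 0. -/
theorem eq_zero_of_smul_mem_range (hV : Module.finrank k V = n + 1) (hn : 1 ≤ n)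
    (h : IsTopPair l n Ω ω) {v : V} (hv : l v = 1)
    (hcomp : ∀ z, linearMatrixMap k D (linearMatrixMap k D' z) = 0)
    (hs : Function.Surjective fun z => Matrix.vecMul z (evalMatrix l D'))
    (hinj : ∀ z, Matrix.vecMul z (evalMatrix l D) = 0 → z = 0) {y : Fin b → k}
    {z : Fin a → ExteriorAlgebra k V} (hz : linearMatrixMap k D z = fun c => y c • ω) : y = 0 := by
  have : FiniteDimensional k V := Module.finite_of_finrank_pos (by omega)
  obtain ⟨m, rfl⟩ : ∃ m, n = m + 1 := ⟨n - 1, by omega⟩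
  obtain ⟨w, hw, hw'⟩ := exists_homogeneous_preimage (p := m)
    (fun c' => Submodule.smul_mem _ _ h.mem) hz
  obtain ⟨η, hη, hη'⟩ := exists_ker_pow_apply_eq (linearMatrixMap k D) hv
    (smul_mem_of_vecMul_surjective _ hcomp hv hs) hw
  have hker : m < Module.finrank k (LinearMap.ker l) := by
    have h1 := LinearMap.finrank_range_add_finrank_ker l
    have h2 := (Submodule.finrank_le (LinearMap.range l)).trans_eq (Module.finrank_self k)
    omega
  have hηz : η = 0 := by
    ext i
    refine eq_zero_of_ι_mul_eq_zero _ hker (ker_pow_le l m (hη i)) fun u hu => ?_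
    have hmem : ∀ i, ι k u * η i ∈ ((LinearMap.ker l).map (ι k)) ^ (m + 1) := fun i => by
      rw [pow_succ']
      exact Submodule.mul_mem_mul ⟨u, hu, rfl⟩ (hη i)
    choose x hx using fun i => h.exists_smul _ (hmem i)
    have h1 : linearMatrixMap k D (fun i => x i • ω) = 0 := by
      rw [show (fun i => x i • ω) = ι k u • η from funext fun i => (hx i).symm, map_smul, hη', hw']
      ext c
      rw [Pi.smul_apply, smul_eq_mul, mul_smul_comm, h.ι_mul, LinearMap.mem_ker.1 hu, zero_smul,
        smul_zero, Pi.zero_apply]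
    have h2 := hinj x (eq_zero_of_linearMatrixMap_smul_top_eq_zero h h1)
    rw [hx, h2, Pi.zero_apply, zero_smul]
  rw [hηz, map_zero] at hη'
  ext c
  have h1 := congrFun (hη'.trans hw') c
  have h2 : ω ≠ 0 := fun h0 => h.ne_zero (by
    have := h.ι_mul v
    rw [h0, mul_zero, hv, one_smul] at this
    exact this.symm)
  exact (smul_eq_zero.1 h1.symm).resolve_right h2

end TopElements

/-! ### A linear form that is bijective from degree zero on. -/

section LinearComplex

variable {k V : Type*} [Field k] [AddCommGroup V] [Module k V] {b : ℕ → ℕ}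
  {D : ∀ i, Fin (b (i + 1)) → Fin (b i) → V}

/-- Contracting the entries of D'D = 0 first with f and then with g leaves exactly the difference of
the two products. -/
theorem sum_eval_mul_eval_comm {a b c : ℕ} {D' : Fin a → Fin b → V} {D : Fin b → Fin c → V}
    (hcomp : ∀ z, linearMatrixMap k D (linearMatrixMap k D' z) = 0) (f g : Module.Dual k V) :
    evalMatrix f D' * evalMatrix g D = evalMatrix g D' * evalMatrix f D := by
  ext i j
  have h1 := congrFun (hcomp (Pi.single i 1)) j
  have h2 : linearMatrixMap k D' (Pi.single i 1) = fun x => ι k (D' i x) := by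
    ext x
    rw [linearMatrixMap_apply, Finset.sum_eq_single i]
    · rw [Pi.single_eq_same, one_mul]
    · intro i' _ hi'
      rw [Pi.single_eq_of_ne hi', zero_mul]
    · exact fun h => absurd (Finset.mem_univ i) h
  rw [h2, linearMatrixMap_apply, Pi.zero_apply] at h1
  have h3 := congrArg (fun x => contract g (contract f x)) h1
  simp only [map_sum, contract_ι_mul, contract_ι, map_sub, map_smul, map_zero,
    Finset.sum_sub_distrib, sub_eq_zero] at h3
  rw [Matrix.mul_apply, Matrix.mul_apply]
  refine algebraMap_leftInverse V |>.injective ?_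
  simpa [evalMatrix, Algebra.smul_def] using h3

/-- A functional vanishing on all the images is a scalar row annihilated by D, which minimality
excludes. -/
theorem iSup_range_mulVec_eq_top {m a c : ℕ} {D : Fin a → Fin c → V} (B : Module.Basis (Fin m) k V)
    (hmin : ∀ z : Fin a → k, linearMatrixMap k D (fun i => algebraMap k _ (z i)) = 0 → z = 0) :
    ⨆ j, LinearMap.range (Matrix.mulVecLin (evalMatrix (B.coord j) D)) = ⊤ := by
  by_contra hne
  obtain ⟨φ, hφ, hle⟩ := Submodule.exists_le_ker_of_lt_top _ (lt_top_iff_ne_top.2 hne)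
  refine hφ ?_
  have hz : (fun i => φ (Pi.single i 1)) = 0 := by
    refine hmin _ ?_
    ext x
    rw [linearMatrixMap_algebraMap, Pi.zero_apply, ι_eq_zero_iff]
    refine B.ext_elem fun j => ?_
    have h1 : φ (Matrix.mulVecLin (evalMatrix (B.coord j) D) (Pi.single x 1)) = 0 :=
      hle (Submodule.mem_iSup_of_mem j (LinearMap.mem_range_self _ _))
    have h2 : ∀ w, φ w = ∑ i, w i * φ (Pi.single i 1) := fun w => by
      conv_lhs => rw [pi_eq_sum_univ' w, map_sum]
      exact Finset.sum_congr rfl fun i _ => by rw [map_smul, smul_eq_mul]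
    rw [h2] at h1
    simpa [evalMatrix, mul_comm] using h1
  refine LinearMap.pi_ext' fun i => LinearMap.ext_ring ?_
  exact congrFun hz i

theorem exists_eventually_bijective_eval [Infinite k] [FiniteDimensional k V]
    (hcomp : ∀ i z, linearMatrixMap k (D i) (linearMatrixMap k (D (i + 1)) z) = 0)
    (hmin : ∀ i (z : Fin (b (i + 1)) → k),
      linearMatrixMap k (D i) (fun a => algebraMap k _ (z a)) = 0 → z = 0)
    {c : ℕ} (hc : ∀ i, b i ≤ c) :
    ∃ l : Module.Dual k V, ∃ i₀, ∀ i ≥ i₀,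
      Function.Bijective (Matrix.mulVecLin (evalMatrix l (D i))) := by
  let B := Module.finBasis k V
  obtain ⟨a, i₀, h⟩ := exists_bijective_pencil b
    (fun i j => Matrix.mulVecLin (evalMatrix (B.coord j) (D i)))
    (fun i j l w => by
      simp only [Matrix.mulVecLin_apply, Matrix.mulVec_mulVec]
      rw [sum_eval_mul_eval_comm (hcomp i)])
    (fun i => iSup_range_mulVec_eq_top B (hmin i)) c hc
  refine ⟨∑ j, a j • B.coord j, i₀, fun i hi => ?_⟩
  convert h i hi using 2
  ext x y
  simp [evalMatrix, Finset.sum_apply, LinearMap.sum_apply]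

theorem vecMul_injective_of_mulVec_surjective {a b : ℕ} {A : Matrix (Fin a) (Fin b) k}
    (h : Function.Surjective A.mulVecLin) (z : Fin a → k) (hz : Matrix.vecMul z A = 0) : z = 0 := by
  obtain ⟨B, hB⟩ := Matrix.mulVec_surjective_iff_exists_right_inverse.1 h
  rw [← Matrix.vecMul_one z, ← hB, ← Matrix.vecMul_vecMul, hz, Matrix.zero_vecMul]

theorem vecMul_surjective_of_mulVec_injective {a b : ℕ} {A : Matrix (Fin a) (Fin b) k}
    (h : Function.Injective A.mulVecLin) : Function.Surjective fun z => Matrix.vecMul z A := by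
  rw [Matrix.vecMul_surjective_iff_exists_left_inverse]
  obtain ⟨g, hg⟩ := LinearMap.exists_leftInverse_of_injective _ (LinearMap.ker_eq_bot.2 h)
  refine ⟨LinearMap.toMatrix' g, ?_⟩
  rw [← LinearMap.toMatrix'_toLin' A, ← LinearMap.toMatrix'_comp]
  change LinearMap.toMatrix' (g ∘ₗ A.mulVecLin) = 1
  rw [hg, LinearMap.toMatrix'_id]

/-- Both halves descend from large degrees: surjectivity of the row action through the top power,
then injectivity through ⋀^n H with surjectivity in all degrees at hand. -/
theorem exists_linear_form_of_linear_complex [Infinite k] {n : ℕ} (hn : 1 ≤ n)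
    (hV : Module.finrank k V = n + 1)
    (hexact : ∀ i, Function.Exact (linearMatrixMap k (D (i + 1))) (linearMatrixMap k (D i)))
    (hmin : ∀ i (z : Fin (b (i + 1)) → k),
      linearMatrixMap k (D i) (fun a => algebraMap k _ (z a)) = 0 → z = 0)
    {c : ℕ} (hc : ∀ i, b i ≤ c)
    (htop : ∀ Ω ∈ ⋀[k]^(n + 1) V, ∀ c, ∃ z, linearMatrixMap k (D 0) z = Pi.single c Ω) :
    ∃ (l : Module.Dual k V) (v : V), l v = 1 ∧
      (Function.Surjective fun z => Matrix.vecMul z (evalMatrix l (D 0))) ∧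
      ∀ z, Matrix.vecMul z (evalMatrix l (D 0)) = 0 → z = 0 := by
  have : FiniteDimensional k V := Module.finite_of_finrank_pos (by omega)
  have : Nontrivial V := Module.nontrivial_of_finrank_pos (R := k) (by omega)
  have hcomp : ∀ i z, linearMatrixMap k (D i) (linearMatrixMap k (D (i + 1)) z) = 0 :=
    fun i z => (hexact i _).2 ⟨z, rfl⟩
  obtain ⟨l, v, hv, i₀, hl⟩ : ∃ (l : Module.Dual k V) (v : V), l v = 1 ∧ ∃ i₀, ∀ i ≥ i₀,
      Function.Bijective (Matrix.mulVecLin (evalMatrix l (D i))) := by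
    obtain ⟨l, i₀, hl⟩ := exists_eventually_bijective_eval hcomp hmin hc
    -- If zero is bijective in large degrees, the spaces there vanish, and any nonzero form serves
    -- as well.
    by_cases h0 : l = 0
    · obtain ⟨u, hu⟩ := exists_ne (0 : V)
      obtain ⟨f, hf⟩ := Module.Projective.exists_dual_ne_zero k hu
      refine ⟨f, (f u)⁻¹ • u, by rw [map_smul, smul_eq_mul, inv_mul_cancel₀ hf], i₀,
        fun i hi => ?_⟩
      have hz : ∀ w, Matrix.mulVecLin (evalMatrix l (D i)) w = 0 := fun w => by
        ext x
        simp [h0, evalMatrix, Matrix.mulVec, dotProduct]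
      refine ⟨fun x y _ => (hl i hi).1 ((hz x).trans (hz y).symm), fun y => ⟨0, ?_⟩⟩
      obtain ⟨w, rfl⟩ := (hl i hi).2 y
      rw [map_zero, hz]
    · obtain ⟨u, hu⟩ : ∃ u, l u ≠ 0 := by
        by_contra! h
        exact h0 (LinearMap.ext h)
      exact ⟨l, (l u)⁻¹ • u, by rw [map_smul, smul_eq_mul, inv_mul_cancel₀ hu], i₀, hl⟩
  refine ⟨l, v, hv, ?_⟩
  obtain ⟨Ω, hΩ, hΩ0, hspan⟩ := exists_top_element hV
  have hp := isTopPair_contract hV hv hΩ hΩ0 hspan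
  -- Beyond degree zero, Ω e_c is a cycle because Ω kills V, hence a boundary.
  have htop' : ∀ i c, ∃ z, linearMatrixMap k (D i) z = Pi.single c Ω := by
    rintro (_ | i)
    · exact htop Ω hΩ
    · intro c
      refine (hexact i _).1 ?_
      ext x
      rw [linearMatrixMap_apply, Finset.sum_eq_zero, Pi.zero_apply]
      intro j _
      rw [Pi.single_apply]
      split_ifs
      · exact hp.top_mul _
      · exact zero_mul _
  have hsurj : ∀ i, Function.Surjective fun z => Matrix.vecMul z (evalMatrix l (D i)) := by
    intro i
    refine Nat.decreasingInduction' (P := fun i =>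
      Function.Surjective fun z => Matrix.vecMul z (evalMatrix l (D i))) (n := max i i₀)
      (fun j _ _ ih => ?_) (le_max_left _ _) ?_
    · exact vecMul_surjective_of_top hp hv (hcomp j) ih (htop' j)
    · exact vecMul_surjective_of_mulVec_injective (hl _ (le_max_right _ _)).1
  refine ⟨hsurj 0, ?_⟩
  refine Nat.decreasingInduction' (P := fun i =>
      ∀ z, Matrix.vecMul z (evalMatrix l (D i)) = 0 → z = 0) (m := 0) (n := i₀)
      (fun j _ _ ih z hz => ?_) (Nat.zero_le _) ?_
  · have h0 : linearMatrixMap k (D j) (fun a => z a • contract l Ω) = 0 := by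
      rw [linearMatrixMap_smul_top hp, hz]
      ext x
      simp
    obtain ⟨w, hw⟩ := (hexact j _).1 h0
    exact eq_zero_of_smul_mem_range hV hn hp hv (hcomp (j + 1)) (hsurj (j + 2)) ih hw
  · exact vecMul_injective_of_mulVec_surjective (hl i₀ le_rfl).2

end LinearComplex

/-! ### The socle of the exterior algebra. -/

section Socle

variable {k V : Type*} [Field k] [AddCommGroup V] [Module k V]

/-- Induction on the exterior algebra through its homogeneous elements. -/
theorem homogeneous_induction {motive : ExteriorAlgebra k V → Prop}
    (mem : ∀ (p : ℕ), ∀ r ∈ ⋀[k]^p V, motive r)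
    (add : ∀ r s, motive r → motive s → motive (r + s)) (r : ExteriorAlgebra k V) : motive r :=
  DirectSum.Decomposition.inductionOn (fun i : ℕ => ⋀[k]^i V) (mem 0 0 (zero_mem _))
    (fun m => mem _ m m.2) add r

/-- The socle of the exterior algebra is its top degree. -/
theorem mem_top_of_ι_mul_eq_zero {n : ℕ} (hV : Module.finrank k V = n + 1)
    {r : ExteriorAlgebra k V} (hr : ∀ u, ι k u * r = 0) : r ∈ ⋀[k]^(n + 1) V := by
  classical
  have : FiniteDimensional k V := Module.finite_of_finrank_pos (by omega)
  let 𝒜 : ℕ → Submodule k (ExteriorAlgebra k V) := fun i => ⋀[k]^i V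
  have hcomp : ∀ i, i ≠ n + 1 → (DirectSum.decompose 𝒜 r i : ExteriorAlgebra k V) = 0 := by
    intro i hi
    have hmem : (DirectSum.decompose 𝒜 r i : ExteriorAlgebra k V) ∈ ⋀[k]^i V := SetLike.coe_mem _
    rcases lt_or_gt_of_ne hi with h | h
    · refine eq_zero_of_ι_mul_eq_zero (⊤ : Submodule k V) (by rwa [finrank_top, hV]) hmem
        fun u _ => ?_
      rw [← DirectSum.coe_decompose_mul_add_of_left_mem 𝒜 (ι_mem_exteriorPower_one u), hr,
        DirectSum.decompose_zero]
      rfl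
    · rwa [exteriorPower_eq_bot (by omega), Submodule.mem_bot] at hmem
  rw [← DirectSum.sum_support_decompose 𝒜 r]
  refine sum_mem fun i _ => ?_
  by_cases hi : i = n + 1
  · subst hi
    exact SetLike.coe_mem _
  · rw [hcomp i hi]
    exact zero_mem _

/-- Every nonzero left ideal of the exterior algebra contains the top degree. -/
theorem exists_mul_eq_top {n : ℕ} (hV : Module.finrank k V = n + 1)
    {Ω : ExteriorAlgebra k V} (hΩ : Ω ∈ ⋀[k]^(n + 1) V) {r : ExteriorAlgebra k V} (hr : r ≠ 0) :
    ∃ s, s * r = Ω := by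
  classical
  have : FiniteDimensional k V := Module.finite_of_finrank_pos (by omega)
  -- Take the least p for which ⋀^p V kills r: a nonzero product from degree p − 1 then lies in the
  -- socle.
  have hex : ∃ p : ℕ, ∀ s ∈ ⋀[k]^p V, s * r = 0 := ⟨n + 2, fun s hs => by
    rw [exteriorPower_eq_bot (by omega), Submodule.mem_bot] at hs
    rw [hs, zero_mul]⟩
  have hpos : Nat.find hex ≠ 0 := fun h0 => hr (by
    have := Nat.find_spec hex
    rw [h0] at this
    have h1 := this 1 (by rw [exteriorPower, pow_zero]; exact Submodule.one_le.1 le_rfl)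
    rwa [one_mul] at h1)
  obtain ⟨p, hp⟩ := Nat.exists_eq_succ_of_ne_zero hpos
  have hmin := Nat.find_min hex (m := p) (by omega)
  have hspec := Nat.find_spec hex
  rw [hp] at hspec
  push Not at hmin
  obtain ⟨s, hs, hsr⟩ := hmin
  have htop : s * r ∈ ⋀[k]^(n + 1) V := mem_top_of_ι_mul_eq_zero hV fun u => by
    rw [← mul_assoc]
    exact hspec _ (ι_mul_mem u hs)
  obtain ⟨Ω', -, hΩ'0, hspan⟩ := exists_top_element hV
  obtain ⟨c, hc⟩ := hspan _ htop
  obtain ⟨c', rfl⟩ := hspan _ hΩ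
  have hc0 : c ≠ 0 := by
    rintro rfl
    exact hsr (by rw [hc, zero_smul])
  exact ⟨(c' * c⁻¹) • s, by rw [smul_mul_assoc, hc, smul_smul, mul_assoc, inv_mul_cancel₀ hc0,
    mul_one]⟩

end Socle

/-! ### Splitting off a free summand. -/

section GradedModules

variable {k V X : Type*} [Field k] [AddCommGroup V] [Module k V]
  [AddCommGroup X] [Module k X] [Module (ExteriorAlgebra k V) X]
  (𝒳 : ℤ → Submodule k X) [DirectSum.Decomposition 𝒳]

/-- The projection of a graded module to a homogeneous component. -/
def homogeneousPart (j : ℤ) : X →ₗ[k] X :=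
  (𝒳 j).subtype ∘ₗ DirectSum.component k ℤ (fun i => 𝒳 i) j ∘ₗ
    (DirectSum.decomposeLinearEquiv 𝒳).toLinearMap

variable {𝒳}

theorem homogeneousPart_of_mem {j : ℤ} {x : X} (hx : x ∈ 𝒳 j) : homogeneousPart 𝒳 j x = x :=
  DirectSum.decompose_of_mem_same 𝒳 hx

theorem homogeneousPart_of_mem_ne {i j : ℤ} {x : X} (hx : x ∈ 𝒳 i) (hij : i ≠ j) :
    homogeneousPart 𝒳 j x = 0 :=
  DirectSum.decompose_of_mem_ne 𝒳 hx hij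

theorem homogeneousPart_mem (j : ℤ) (x : X) : homogeneousPart 𝒳 j x ∈ 𝒳 j :=
  SetLike.coe_mem _

variable [SetLike.GradedSMul (extGrading k V) 𝒳]

omit [DirectSum.Decomposition 𝒳] in
theorem smul_mem_graded {p : ℕ} {r : ExteriorAlgebra k V} (hr : r ∈ ⋀[k]^p V) {j : ℤ} {x : X}
    (hx : x ∈ 𝒳 j) : r • x ∈ 𝒳 (p + j) :=
  SetLike.GradedSMul.smul_mem (A := extGrading k V) (B := 𝒳) (i := (p : ℤ)) hr hx

theorem homogeneousPart_smul {p : ℕ} {r : ExteriorAlgebra k V} (hr : r ∈ ⋀[k]^p V) (j : ℤ)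
    (x : X) : homogeneousPart 𝒳 (p + j) (r • x) = r • homogeneousPart 𝒳 j x := by
  induction x using DirectSum.Decomposition.inductionOn 𝒳 with
  | zero => rw [smul_zero, map_zero, map_zero, smul_zero]
  | @homogeneous i m =>
    by_cases h : i = j
    · subst h
      rw [homogeneousPart_of_mem (smul_mem_graded hr m.2), homogeneousPart_of_mem m.2]
    · rw [homogeneousPart_of_mem_ne (smul_mem_graded hr m.2) (by omega),
        homogeneousPart_of_mem_ne m.2 h, smul_zero]
  | add x y hx hy => rw [smul_add, map_add, map_add, smul_add, hx, hy]

theorem span_singleton_isHomogeneous {j : ℤ} {x : X} (hx : x ∈ 𝒳 j) :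
    (Submodule.span (ExteriorAlgebra k V) {x}).IsHomogeneous 𝒳 := by
  intro i y hy
  obtain ⟨r, rfl⟩ := Submodule.mem_span_singleton.1 hy
  change homogeneousPart 𝒳 i (r • x) ∈ _
  induction r using homogeneous_induction with
  | mem p r hr =>
    by_cases h : (p : ℤ) + j = i
    · subst h
      rw [homogeneousPart_smul hr, homogeneousPart_of_mem hx]
      exact Submodule.smul_mem _ _ (Submodule.mem_span_singleton_self x)
    · rw [homogeneousPart_of_mem_ne (smul_mem_graded hr hx) h]
      exact zero_mem _
  | add r s hr hs =>
    rw [add_smul, map_add]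
    exact add_mem (hr (Submodule.smul_mem _ _ (Submodule.mem_span_singleton_self x)))
      (hs (Submodule.smul_mem _ _ (Submodule.mem_span_singleton_self x)))

variable [IsScalarTower k (ExteriorAlgebra k V) X]

variable (V) in
/-- The largest submodule contained in the kernel of a linear form. -/
def coreKer (f : Module.Dual k X) : Submodule (ExteriorAlgebra k V) X where
  carrier := {y | ∀ r : ExteriorAlgebra k V, f (r • y) = 0}
  add_mem' hx hy r := by rw [smul_add, map_add, hx r, hy r, add_zero]
  zero_mem' r := by rw [smul_zero, map_zero]
  smul_mem' s y hy r := by rw [← mul_smul]; exact hy _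

omit [IsScalarTower k (ExteriorAlgebra k V) X] in
theorem coreKer_isHomogeneous {f : Module.Dual k X} {d : ℤ}
    (hf : ∀ x, f (homogeneousPart 𝒳 d x) = f x) : (coreKer V f).IsHomogeneous 𝒳 := by
  intro i y hy r
  change f (r • homogeneousPart 𝒳 i y) = 0
  induction r using homogeneous_induction with
  | mem p r hr =>
    rw [← hf]
    by_cases h : (p : ℤ) + i = d
    · subst h
      rw [homogeneousPart_smul hr, homogeneousPart_of_mem (homogeneousPart_mem _ _),
        ← homogeneousPart_smul hr, hf]
      exact hy r
    · rw [homogeneousPart_of_mem_ne (smul_mem_graded hr (homogeneousPart_mem _ _)) h, map_zero]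
  | add r s hr hs => rw [add_smul, map_add, hr, hs, add_zero]

/-- In an indecomposable module, an element of degree zero not annihilated by the top degree of
the exterior algebra is a free generator. -/
theorem bijective_smul_of_top_smul_ne_zero {n : ℕ} (hV : Module.finrank k V = n + 1)
    (hind : IsGradedIndecomposable V 𝒳) {x : X} (hx : x ∈ 𝒳 0) {Ω : ExteriorAlgebra k V}
    (hΩ : Ω ∈ ⋀[k]^(n + 1) V) (h0 : Ω • x ≠ 0) :
    Function.Bijective (LinearMap.toSpanSingleton (ExteriorAlgebra k V) X x) := by
  have : FiniteDimensional k V := Module.finite_of_finrank_pos (by omega)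
  have hinj : ∀ r : ExteriorAlgebra k V, r • x = 0 → r = 0 := by
    intro r hr
    by_contra hne
    obtain ⟨s, hs⟩ := exists_mul_eq_top hV hΩ hne
    exact h0 (by rw [← hs, mul_smul, hr, smul_zero])
  refine ⟨(injective_iff_map_eq_zero _).2 hinj, ?_⟩
  obtain ⟨g, hg⟩ := Module.Projective.exists_dual_ne_zero k h0
  -- Restricting the functional to the degree of Ω x makes `coreKer V f` a graded submodule.
  let f : Module.Dual k X := g ∘ₗ homogeneousPart 𝒳 (((n + 1 : ℕ) : ℤ) + 0)
  have hf : ∀ y, f (homogeneousPart 𝒳 (((n + 1 : ℕ) : ℤ) + 0) y) = f y := fun y => by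
    simp only [f, LinearMap.comp_apply, homogeneousPart_of_mem (homogeneousPart_mem _ _)]
  have hfΩ : f (Ω • x) ≠ 0 := by
    simpa only [f, LinearMap.comp_apply, homogeneousPart_of_mem (smul_mem_graded hΩ hx)] using hg
  have hpair : ∀ r : ExteriorAlgebra k V,
      (∀ s : ExteriorAlgebra k V, f (s • r • x) = 0) → r = 0 := by
    intro r hr
    by_contra hne
    obtain ⟨s, hs⟩ := exists_mul_eq_top hV hΩ hne
    exact hfΩ (by rw [← hs, mul_smul, hr])
  -- The pairing f(s r x) is nondegenerate because every nonzero left ideal contains Ω. So for any y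
  -- the functional s ↦ f(s y) is s ↦ f(s r x) for some r, and y − r x lies in the complement.
  let Ψ : ExteriorAlgebra k V →ₗ[k] Module.Dual k (ExteriorAlgebra k V) :=
    LinearMap.mk₂ k (fun r s => f (s • r • x))
      (fun r r' s => by simp only [add_smul, smul_add, map_add])
      (fun c r s => by rw [smul_assoc, smul_algebra_smul_comm, map_smul])
      (fun r s s' => by simp only [add_smul, map_add])
      (fun c r s => by rw [smul_assoc, map_smul])
  have hΨ : Function.Surjective Ψ :=
    (LinearMap.injective_iff_surjective_of_finrank_eq_finrank Subspace.dual_finrank_eq.symm).1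
      ((injective_iff_map_eq_zero _).2 fun r hr => hpair r fun s => LinearMap.congr_fun hr s)
  have hcompl : IsCompl (Submodule.span (ExteriorAlgebra k V) {x}) (coreKer V f) := by
    refine IsCompl.of_eq ?_ ?_
    · refine (Submodule.eq_bot_iff _).2 ?_
      rintro y ⟨hy, hy'⟩
      obtain ⟨r, rfl⟩ := Submodule.mem_span_singleton.1 hy
      rw [hpair r hy', zero_smul]
    · refine Submodule.eq_top_iff'.2 fun y => ?_
      obtain ⟨r, hr⟩ := hΨ ((f.comp
        ((LinearMap.toSpanSingleton (ExteriorAlgebra k V) X y).restrictScalars k)))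
      rw [← add_sub_cancel (r • x) y]
      refine Submodule.add_mem_sup (Submodule.mem_span_singleton.2 ⟨r, rfl⟩) fun s => ?_
      rw [smul_sub, map_sub, sub_eq_zero]
      exact (LinearMap.congr_fun hr s).symm
  have hx0 : x ≠ 0 := fun h => h0 (by rw [h, smul_zero])
  rcases hind.2 _ _ (span_singleton_isHomogeneous hx) (coreKer_isHomogeneous hf) hcompl with h | h
  · exact absurd (Submodule.span_singleton_eq_bot.1 h) hx0
  · rw [h] at hcompl
    have htop := hcompl.sup_eq_top
    rw [sup_bot_eq] at htop
    intro y
    exact Submodule.mem_span_singleton.1 (htop ▸ Submodule.mem_top : y ∈ _)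

end GradedModules

/-! ### Consequences of linearity and minimality. -/

section LinearResolution

variable {k V X : Type*} [Field k] [AddCommGroup V] [Module k V]
  [AddCommGroup X] [Module k X] [Module (ExteriorAlgebra k V) X]
  [IsScalarTower k (ExteriorAlgebra k V) X] {𝒳 : ℤ → Submodule k X}

theorem single_mem_freeGrading {m : ℕ} (deg : Fin m → ℤ) (a : Fin m) :
    Pi.single a (1 : ExteriorAlgebra k V) ∈ freeGrading k V deg (deg a) := by
  intro c
  by_cases h : c = a
  · subst h
    rw [Pi.single_eq_same, sub_self]
    change (1 : ExteriorAlgebra k V) ∈ ⋀[k]^0 V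
    rw [exteriorPower, pow_zero]
    exact Submodule.one_le.1 le_rfl
  · rw [Pi.single_eq_of_ne h]
    exact zero_mem _

namespace GradedFreeResolution

theorem IsMinimal.rank_succ_eq_zero {F : GradedFreeResolution V 𝒳} (hF : F.IsMinimal) {i : ℕ}
    (h : F.d i = 0) : F.rank (i + 1) = 0 := by
  by_contra hne
  let a : Fin (F.rank (i + 1)) := ⟨0, Nat.pos_of_ne_zero hne⟩
  have h1 := hF.algebraMapInv_eq_zero (i := i) (x := Pi.single a 1) (by rw [h]; rfl) a
  rw [Pi.single_eq_same, map_one] at h1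
  exact one_ne_zero h1

theorem IsMinimal.rank_eq_zero_of_injective {F : GradedFreeResolution V 𝒳} (hF : F.IsMinimal)
    (h : Function.Injective F.aug) (i : ℕ) : F.rank (i + 1) = 0 := by
  suffices h : F.d i = 0 from hF.rank_succ_eq_zero h
  induction i with
  | zero =>
    refine LinearMap.ext fun x => h ?_
    rw [LinearMap.zero_apply, map_zero]
    exact (F.exact_aug _).2 ⟨x, rfl⟩
  | succ i ih =>
    refine LinearMap.ext fun x => funext fun a => ?_
    exact (Nat.not_lt_zero _ (a.2.trans_eq (hF.rank_succ_eq_zero ih))).elim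

/-- The generators of consecutive terms differ in degree by one, so the matrix entries lie in ⋀¹V =
V. -/
theorem exists_linearMatrix {F : GradedFreeResolution V 𝒳} (hdeg : ∀ i a, F.deg i a = i) :
    ∃ D : ∀ i, Fin (F.rank (i + 1)) → Fin (F.rank i) → V,
      ∀ i, F.d i = linearMatrixMap k (D i) := by
  have h : ∀ i a c, ∃ u : V, ι k u = F.d i (Pi.single a 1) c := by
    intro i a c
    have h1 := F.d_mem i _ _ (single_mem_freeGrading (F.deg (i + 1)) a) c
    rw [hdeg, hdeg, show (((i + 1 : ℕ) : ℤ) - (i : ℤ)) = ((1 : ℕ) : ℤ) by push_cast; ring] at h1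
    change _ ∈ ⋀[k]^1 V at h1
    rwa [exteriorPower, pow_one] at h1
  choose D hD using h
  refine ⟨D, fun i => LinearMap.ext fun z => ?_⟩
  rw [apply_eq_sum_smul]
  ext c
  rw [linearMatrixMap_apply, Finset.sum_apply]
  exact Finset.sum_congr rfl fun a _ => by rw [Pi.smul_apply, smul_eq_mul, hD]

theorem aug_single_mem {F : GradedFreeResolution V 𝒳} (hdeg : ∀ i a, F.deg i a = i)
    (a : Fin (F.rank 0)) : F.aug (Pi.single a 1) ∈ 𝒳 0 := by
  have h := F.aug_mem _ _ (single_mem_freeGrading (F.deg 0) a)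
  rwa [hdeg] at h

/-- The top degree of the exterior algebra annihilates the generators of an indecomposable
linear module of complexity one. -/
theorem top_smul_aug_single_eq_zero [DirectSum.Decomposition 𝒳]
    [SetLike.GradedSMul (extGrading k V) 𝒳] {n : ℕ}
    (hV : Module.finrank k V = n + 1) (hind : IsGradedIndecomposable V 𝒳)
    (hcx : complexity V 𝒳 = 1) {F : GradedFreeResolution V 𝒳} (hF : F.IsMinimal)
    (hdeg : ∀ i a, F.deg i a = i) {Ω : ExteriorAlgebra k V} (hΩ : Ω ∈ ⋀[k]^(n + 1) V)
    (a : Fin (F.rank 0)) : Ω • F.aug (Pi.single a 1) = 0 := by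
  have : FiniteDimensional k V := Module.finite_of_finrank_pos (by omega)
  by_contra hne
  set x := F.aug (Pi.single a 1) with hx
  have hbij := bijective_smul_of_top_smul_ne_zero hV hind (aug_single_mem hdeg a) hΩ hne
  -- X is free on x, so it is its own minimal cover; comparison makes the augmentation injective and
  -- all later ranks zero.
  obtain ⟨-, f, hf⟩ := exists_cover_equiv (a := 1)
    (LinearMap.toSpanSingleton (ExteriorAlgebra k V) X x ∘ₗ LinearMap.proj 0) F.aug
    (hbij.2.comp (LinearMap.proj_surjective _)) F.aug_surjective
    (fun z hz i => by
      have h1 : z 0 = 0 := hbij.1 (by rw [map_zero]; exact hz)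
      rw [Subsingleton.elim i 0, h1, map_zero])
    (fun z hz => by obtain ⟨y, rfl⟩ := (F.exact_aug z).1 hz; exact hF 0 y)
    (LinearEquiv.refl _ _)
  have hinj : Function.Injective F.aug := by
    refine (injective_iff_map_eq_zero _).2 fun z hz => ?_
    have h1 := hf (f.symm z)
    rw [f.apply_symm_apply, hz] at h1
    have h2 : f.symm z 0 = 0 := hbij.1 (by rw [map_zero]; exact h1.symm)
    refine f.symm.injective ?_
    rw [map_zero]
    ext i
    rw [Subsingleton.elim i 0, h2, Pi.zero_apply]
  obtain ⟨i, hi, hi'⟩ := exists_rank_ne_zero_of_complexity_eq_one hcx hF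
  obtain ⟨i, rfl⟩ := Nat.exists_eq_add_of_le' hi
  exact hi' (hF.rank_eq_zero_of_injective hinj i)

end GradedFreeResolution

end LinearResolution

/-! ### Derivations into the endomorphisms of a module. -/

section Derivation

variable {k V X : Type*} [Field k] [AddCommGroup V] [Module k V]
  [AddCommGroup X] [Module k X] [Module (ExteriorAlgebra k V) X]
  [IsScalarTower k (ExteriorAlgebra k V) X]

/-- A linear map `ψ : V → End X` with `u ψ(u) + ψ(u) u = 0` extends to a derivation from the
exterior algebra to `End X`. -/
theorem exists_derivation (ψ : V →ₗ[k] Module.End k X)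
    (hψ : ∀ u x, ι k u • ψ u x + ψ u (ι k u • x) = 0) :
    ∃ θ : ExteriorAlgebra k V →ₗ[k] Module.End k X,
      (∀ r s x, θ (r * s) x = r • θ s x + θ r (s • x)) ∧ ∀ u, θ (ι k u) = ψ u := by
  let L : ExteriorAlgebra k V →ₐ[k] Module.End k X := Algebra.lsmul k k X
  -- A derivation is the off-diagonal entry of a triangular action on X × X; the condition on ψ says
  -- that these operators square to zero.
  let B : V →ₗ[k] Module.End k (X × X) :=
    { toFun := fun u => (L (ι k u) ∘ₗ LinearMap.fst k X X).prod
        (L (ι k u) ∘ₗ LinearMap.snd k X X + ψ u ∘ₗ LinearMap.fst k X X)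
      map_add' := fun u w => by
        ext x <;> simp [L]
      map_smul' := fun c u => by
        ext x <;> simp [L] }
  have hB : ∀ u x y, B u (x, y) = (ι k u • x, ι k u • y + ψ u x) := fun _ _ _ => rfl
  have hsq : ∀ u, B u * B u = 0 := fun u => by
    refine LinearMap.ext fun ⟨x, y⟩ => ?_
    rw [Module.End.mul_apply, hB, hB, LinearMap.zero_apply, smul_add, ← mul_smul, ← mul_smul,
      ι_sq_zero, zero_smul, zero_smul, zero_add, hψ]
    rfl
  let ρ := ExteriorAlgebra.lift k ⟨B, hsq⟩
  have hρι : ∀ u, ρ (ι k u) = B u := fun u => lift_ι_apply k B hsq u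
  let θ : ExteriorAlgebra k V →ₗ[k] Module.End k X :=
    { toFun := fun r => LinearMap.snd k X X ∘ₗ ρ r ∘ₗ LinearMap.inl k X X
      map_add' := fun r s => by ext x; simp
      map_smul' := fun c r => by ext x; simp }
  have hθ : ∀ r x, θ r x = (ρ r (x, 0)).2 := fun _ _ => rfl
  have hρ : ∀ r x y, ρ r (x, y) = (r • x, r • y + θ r x) := by
    intro r
    induction r using ExteriorAlgebra.induction with
    | algebraMap c =>
      intro x y
      rw [hθ, AlgHom.commutes]
      simp [Module.algebraMap_end_apply]
    | ι u =>
      intro x y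
      rw [hθ, hρι, hB, hB, smul_zero, zero_add]
    | mul r s hr hs =>
      intro x y
      rw [hθ, map_mul, Module.End.mul_apply, Module.End.mul_apply, hs, hr, hs, hr]
      simp [mul_smul, add_assoc]
    | add r s hr hs =>
      intro x y
      rw [hθ, map_add, LinearMap.add_apply, LinearMap.add_apply, hr, hs, hr, hs, smul_zero,
        smul_zero, zero_add, zero_add, Prod.mk_add_mk, Prod.mk_add_mk, add_smul, add_smul,
        add_add_add_comm]
  refine ⟨θ, fun r s x => ?_, fun u => LinearMap.ext fun x => ?_⟩
  · rw [hθ, map_mul, Module.End.mul_apply, hρ s, hρ r, smul_zero, zero_add]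
  · rw [hθ, hρι, hB, smul_zero, zero_add]

omit [IsScalarTower k (ExteriorAlgebra k V) X] in
theorem derivation_mem {𝒳 : ℤ → Submodule k X} [SetLike.GradedSMul (extGrading k V) 𝒳]
    {θ : ExteriorAlgebra k V →ₗ[k] Module.End k X}
    (hθ : ∀ r s x, θ (r * s) x = r • θ s x + θ r (s • x))
    (hι : ∀ u j, ∀ x ∈ 𝒳 j, θ (ι k u) x ∈ 𝒳 (1 + j)) {p : ℕ} {r : ExteriorAlgebra k V}
    (hr : r ∈ ⋀[k]^p V) {j : ℤ} {x : X} (hx : x ∈ 𝒳 j) : θ r x ∈ 𝒳 (p + j) := by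
  have hone : ∀ x, θ 1 x = 0 := fun x => by
    have := hθ 1 1 x
    rwa [mul_one, one_smul, one_smul, left_eq_add] at this
  induction p generalizing r with
  | zero =>
    obtain ⟨c, rfl⟩ := exteriorPower_zero_eq_algebraMap hr
    rw [Algebra.algebraMap_eq_smul_one, map_smul, LinearMap.smul_apply, hone, smul_zero]
    exact zero_mem _
  | succ p ih =>
    rw [exteriorPower, pow_succ'] at hr
    have e : ((p + 1 : ℕ) : ℤ) + j = 1 + (p + j) := by push_cast; ring
    rw [e]
    induction hr using Submodule.mul_induction_on' with
    | mem_mul_mem m hm s hs =>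
      obtain ⟨u, rfl⟩ := hm
      rw [hθ]
      refine add_mem ?_ (hι _ _ _ (smul_mem_graded hs hx))
      exact_mod_cast smul_mem_graded (ι_mem_exteriorPower_one u) (ih hs)
    | add r _ s _ hr hs =>
      rw [map_add, LinearMap.add_apply]
      exact add_mem hr hs

end Derivation

/-! ### Vanishing of Ext¹ makes derivations inner. -/

section Lifting

variable {k V X : Type*} [Field k] [AddCommGroup V] [Module k V]
  [AddCommGroup X] [Module k X] [Module (ExteriorAlgebra k V) X]
  {𝒳 : ℤ → Submodule k X} [DirectSum.Decomposition 𝒳] [SetLike.GradedSMul (extGrading k V) 𝒳]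

theorem exists_smul_eq_homogeneousPart {i : ℤ} {x : X} (hx : x ∈ 𝒳 i) (j : ℤ)
    (r : ExteriorAlgebra k V) :
    ∃ s ∈ extGrading k V (j - i), s • x = homogeneousPart 𝒳 j (r • x) := by
  induction r using homogeneous_induction with
  | mem p r hr =>
    by_cases h : (p : ℤ) + i = j
    · subst h
      refine ⟨r, ?_, (homogeneousPart_of_mem (smul_mem_graded hr hx)).symm⟩
      rw [add_sub_cancel_right]
      exact hr
    · refine ⟨0, zero_mem _, ?_⟩
      rw [homogeneousPart_of_mem_ne (smul_mem_graded hr hx) h, zero_smul]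
  | add r s hr hs =>
    obtain ⟨r', hr', e⟩ := hr
    obtain ⟨s', hs', e'⟩ := hs
    exact ⟨r' + s', add_mem hr' hs', by rw [add_smul, add_smul, map_add, e, e']⟩

variable [IsScalarTower k (ExteriorAlgebra k V) X]

namespace GradedFreeResolution

variable (F : GradedFreeResolution V 𝒳)

/-- The augmentation is surjective in each degree. -/
theorem exists_homogeneous_aug_eq {j : ℤ} {x : X} (hx : x ∈ 𝒳 j) :
    ∃ z ∈ freeGrading k V (F.deg 0) j, F.aug z = x := by
  obtain ⟨z, rfl⟩ := F.aug_surjective x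
  have hmem : ∀ a, F.aug (Pi.single a 1) ∈ 𝒳 (F.deg 0 a) := fun a =>
    F.aug_mem _ _ (single_mem_freeGrading (F.deg 0) a)
  choose w hw hw' using fun a => exists_smul_eq_homogeneousPart (hmem a) j (z a)
  refine ⟨w, hw, ?_⟩
  rw [← homogeneousPart_of_mem hx, apply_eq_sum_smul, apply_eq_sum_smul F.aug z, map_sum]
  exact Finset.sum_congr rfl fun a _ => hw' a

omit [DirectSum.Decomposition 𝒳] [SetLike.GradedSMul (extGrading k V) 𝒳] in
theorem exists_comp_eq_of_ext_subsingleton (h : ¬ Nontrivial (F.Ext 𝒳 1))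
    {g : (Fin (F.rank 1) → ExteriorAlgebra k V) →ₗ[ExteriorAlgebra k V] X}
    (hg : g ∈ gradedHom V (freeGrading k V (F.deg 1)) 𝒳) (hg0 : g ∘ₗ F.d 1 = 0) :
    ∃ f ∈ gradedHom V (freeGrading k V (F.deg 0)) 𝒳, f ∘ₗ F.d 0 = g := by
  rw [Submodule.Quotient.nontrivial_iff, not_not] at h
  let g' : F.Cochains 𝒳 1 := ⟨g, hg⟩
  have hker : g' ∈ LinearMap.ker (F.coboundary 𝒳 1) := Subtype.ext hg0
  have h1 : (⟨g', hker⟩ : LinearMap.ker (F.coboundary 𝒳 1)) ∈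
      (F.coboundaries 𝒳 1).submoduleOf (LinearMap.ker (F.coboundary 𝒳 1)) :=
    h ▸ Submodule.mem_top
  obtain ⟨f, hf⟩ : g' ∈ LinearMap.range (F.coboundary 𝒳 0) := h1
  exact ⟨f.1, f.2, congrArg Subtype.val hf⟩

/-- If `Ext¹(X, X) = 0`, every graded derivation to `End X` is inner. -/
theorem exists_commutator_eq_of_ext_subsingleton (h : ¬ Nontrivial (F.Ext 𝒳 1))
    {θ : ExteriorAlgebra k V →ₗ[k] Module.End k X}
    (hθ : ∀ r s x, θ (r * s) x = r • θ s x + θ r (s • x))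
    (hι : ∀ u j, ∀ x ∈ 𝒳 j, θ (ι k u) x ∈ 𝒳 (1 + j)) :
    ∃ p : Module.End k X, (∀ j, ∀ x ∈ 𝒳 j, p x ∈ 𝒳 j) ∧
      ∀ r x, p (r • x) = r • p x + θ r x := by
  let x : Fin (F.rank 0) → X := fun a => F.aug (Pi.single a 1)
  -- The map τ is R-linear up to the term θ(r) ∘ aug. That term vanishes on the image of d, so τ ∘ d
  -- is an R-linear 1-cocycle.
  let τ : (Fin (F.rank 0) → ExteriorAlgebra k V) →ₗ[k] X :=
    { toFun := fun z => ∑ a, θ (z a) (x a)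
      map_add' := fun z w => by simp [Finset.sum_add_distrib]
      map_smul' := fun c z => by simp [Finset.smul_sum] }
  have hτ : ∀ z, τ z = ∑ a, θ (z a) (x a) := fun _ => rfl
  have hτsmul : ∀ (r : ExteriorAlgebra k V) z, τ (r • z) = r • τ z + θ r (F.aug z) := by
    intro r z
    rw [hτ, hτ, apply_eq_sum_smul F.aug z, map_sum, Finset.smul_sum, ← Finset.sum_add_distrib]
    exact Finset.sum_congr rfl fun a _ => by rw [Pi.smul_apply, smul_eq_mul, hθ]
  have hτmem : ∀ j, ∀ z ∈ freeGrading k V (F.deg 0) j, τ z ∈ 𝒳 j := by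
    intro j z hz
    rw [hτ]
    refine sum_mem fun a _ => ?_
    have h1 : z a ∈ extGrading k V (j - F.deg 0 a) := hz a
    have h2 : x a ∈ 𝒳 (F.deg 0 a) := F.aug_mem _ _ (single_mem_freeGrading (F.deg 0) a)
    rcases hj : j - F.deg 0 a with p | p
    · rw [hj] at h1
      have := derivation_mem hθ hι h1 h2
      rwa [show (p : ℤ) + F.deg 0 a = j by
        have h3 : j - F.deg 0 a = (p : ℤ) := hj
        omega] at this
    · rw [hj] at h1
      rw [(Submodule.mem_bot k).1 h1, map_zero]
      exact zero_mem _
  have haug : ∀ z, F.aug (F.d 0 z) = 0 := fun z => (F.exact_aug _).2 ⟨z, rfl⟩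
  let g : (Fin (F.rank 1) → ExteriorAlgebra k V) →ₗ[ExteriorAlgebra k V] X :=
    { toFun := fun z => τ (F.d 0 z)
      map_add' := fun z w => by rw [map_add, map_add]
      map_smul' := fun r z => by
        rw [map_smul, hτsmul, haug, map_zero, add_zero]; rfl }
  obtain ⟨f, hf, hfg⟩ := F.exists_comp_eq_of_ext_subsingleton h (g := g)
    (fun j z hz => hτmem j _ (F.d_mem 0 j z hz))
    (LinearMap.ext fun z => by
      change τ (F.d 0 (F.d 1 z)) = 0
      rw [(F.exact_d 0 _).2 ⟨z, rfl⟩, map_zero])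
  obtain ⟨s, hs⟩ := LinearMap.exists_rightInverse_of_surjective (F.aug.restrictScalars k)
    (LinearMap.range_eq_top.2 F.aug_surjective)
  have hs' : ∀ y, F.aug (s y) = y := fun y => LinearMap.congr_fun hs y
  -- As f and τ agree on the image of d, the difference τ − f descends along the augmentation,
  -- whatever section s is used.
  let p : Module.End k X := (τ - f.restrictScalars k) ∘ₗ s
  have hp : ∀ z, p (F.aug z) = τ z - f z := by
    intro z
    obtain ⟨w, hw⟩ := (F.exact_aug (s (F.aug z) - z)).1 (by rw [map_sub, hs', sub_self])
    have h1 : f (F.d 0 w) = τ (F.d 0 w) := LinearMap.congr_fun hfg w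
    rw [hw, map_sub, map_sub] at h1
    change τ (s (F.aug z)) - f (s (F.aug z)) = _
    rw [sub_eq_sub_iff_sub_eq_sub, ← h1]
  refine ⟨p, fun j y hy => ?_, fun r y => ?_⟩
  · obtain ⟨z, hz, rfl⟩ := F.exists_homogeneous_aug_eq hy
    rw [hp]
    exact sub_mem (hτmem j z hz) (hf j z hz)
  · obtain ⟨z, rfl⟩ := F.aug_surjective y
    rw [← map_smul, hp, hp, hτsmul, map_smul, smul_sub]
    abel

end GradedFreeResolution

end Lifting

/-! ### A dimension count for linear relations. -/

section Relation

/-- If a linear relation on a finite-dimensional space has injective first projection and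
surjective second projection, then the second projection is injective. -/
theorem eq_zero_of_mem_relation {k C : Type*} [Field k] [AddCommGroup C] [Module k C]
    [FiniteDimensional k C] {Γ : Submodule k (C × C)} (h1 : ∀ f, (0, f) ∈ Γ → f = 0)
    (h2 : ∀ f, ∃ p, (p, f) ∈ Γ) {p : C} (hp : (p, 0) ∈ Γ) : p = 0 := by
  let π₁ : Γ →ₗ[k] C := LinearMap.fst k C C ∘ₗ Γ.subtype
  let π₂ : Γ →ₗ[k] C := LinearMap.snd k C C ∘ₗ Γ.subtype
  have hinj : Function.Injective π₁ := by
    rw [injective_iff_map_eq_zero]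
    rintro ⟨⟨q, f⟩, hq⟩ h0
    change q = 0 at h0
    subst h0
    exact Subtype.ext (Prod.ext rfl (h1 f hq))
  have hsurj : Function.Surjective π₂ := fun f => by
    obtain ⟨q, hq⟩ := h2 f
    exact ⟨⟨(q, f), hq⟩, rfl⟩
  have hfin : Module.finrank k Γ = Module.finrank k C :=
    le_antisymm (LinearMap.finrank_le_finrank_of_injective hinj)
      (LinearMap.finrank_le_finrank_of_surjective hsurj)
  have h3 := (LinearMap.injective_iff_surjective_of_finrank_eq_finrank hfin).2 hsurj
  have h4 : (⟨(p, 0), hp⟩ : Γ) = 0 := h3 rfl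
  exact congrArg (fun q : Γ => q.1.1) h4

end Relation

/-! ### First order deformations of the action of v. -/

section Deformation

variable {k V X : Type*} [Field k] [AddCommGroup V] [Module k V]
  [AddCommGroup X] [Module k X] [Module (ExteriorAlgebra k V) X]
  [IsScalarTower k (ExteriorAlgebra k V) X]
  (𝒳 : ℤ → Submodule k X) (l : Module.Dual k V) (v h : V)

/-- The degree zero endomorphisms commuting with the hyperplane `ker l` for which translation by
`h` defines a first order deformation of the action of `v`. -/
def deformations : Submodule k (Module.End k X) where
  carrier := {f | (∀ j, ∀ x ∈ 𝒳 j, f x ∈ 𝒳 j) ∧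
    (∀ u ∈ LinearMap.ker l, ∀ x, f (ι k u • x) = ι k u • f x) ∧
    ∀ x, ι k h • f (ι k v • x) = ι k h • ι k v • f x}
  add_mem' hf hg := ⟨fun j x hx => add_mem (hf.1 j x hx) (hg.1 j x hx),
    fun u hu x => by simp [hf.2.1 u hu, hg.2.1 u hu],
    fun x => by simp only [LinearMap.add_apply, smul_add, hf.2.2, hg.2.2]⟩
  zero_mem' := ⟨fun _ _ _ => zero_mem _, fun u _ x => by simp, fun x => by simp⟩
  smul_mem' c f hf := ⟨fun j x hx => Submodule.smul_mem _ c (hf.1 j x hx),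
    fun u hu x => by
      rw [LinearMap.smul_apply, LinearMap.smul_apply, hf.2.1 u hu, smul_algebra_smul_comm],
    fun x => by
      simp only [LinearMap.smul_apply]
      rw [smul_algebra_smul_comm, hf.2.2, smul_algebra_smul_comm, smul_algebra_smul_comm]⟩

/-- The pairs `(p, f)` of deformations with `[p, v] = h f`. -/
def deformationPairs :
    Submodule k (deformations 𝒳 l v h × deformations 𝒳 l v h) where
  carrier := {q | ∀ x, q.1.1 (ι k v • x) = ι k v • q.1.1 x + ι k h • q.2.1 x}
  add_mem' {q q'} hq hq' x := by
    change q.1.1 _ + q'.1.1 _ = ι k v • (q.1.1 x + q'.1.1 x) + ι k h • (q.2.1 x + q'.2.1 x)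
    rw [hq, hq', smul_add, smul_add, add_add_add_comm]
  zero_mem' x := by
    change (0 : X) = ι k v • (0 : X) + ι k h • (0 : X)
    rw [smul_zero, smul_zero, add_zero]
  smul_mem' c q hq x := by
    change c • q.1.1 _ = ι k v • (c • q.1.1 x) + ι k h • (c • q.2.1 x)
    rw [hq, smul_add, smul_algebra_smul_comm, smul_algebra_smul_comm]

variable {𝒳 l v h}

/-- The derivation killing ker l and sending v to h f is inner, given by p. Multiplying [p, v] = h f
by h gives zero, so p satisfies the condition imposed on f. -/
theorem exists_deformation_of_ext_subsingleton [DirectSum.Decomposition 𝒳]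
    [SetLike.GradedSMul (extGrading k V) 𝒳] (F : GradedFreeResolution V 𝒳)
    (hF : ¬ Nontrivial (F.Ext 𝒳 1)) (hv : l v = 1) (f : deformations 𝒳 l v h) :
    ∃ p : deformations 𝒳 l v h, (p, f) ∈ deformationPairs 𝒳 l v h := by
  obtain ⟨f, hf0, hf1, hf2⟩ := f
  let ψ : V →ₗ[k] Module.End k X :=
    { toFun := fun u => l u • (Algebra.lsmul k k X (ι k h) ∘ₗ f)
      map_add' := fun u w => by rw [map_add, add_smul]
      map_smul' := fun c u => by rw [map_smul, smul_assoc]; rfl }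
  have hψ : ∀ u x, ψ u x = l u • ι k h • f x := fun _ _ => rfl
  -- After multiplication by h, f commutes with all of V; this and h u + u h = 0 give the condition
  -- for ψ to extend.
  have hcomm : ∀ (u : V) (x : X), ι k h • f (ι k u • x) = ι k h • ι k u • f x := by
    intro u x
    have e : ι k u = ι k (u - l u • v) + l u • ι k v := by
      rw [← LinearMap.map_smul, ← LinearMap.map_add, sub_add_cancel]
    have hu : u - l u • v ∈ LinearMap.ker l := by
      rw [LinearMap.mem_ker, map_sub, map_smul, hv, smul_eq_mul, mul_one, sub_self]
    rw [e, add_smul, add_smul, map_add, hf1 _ hu, smul_add, smul_add]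
    congr 1
    rw [smul_assoc, smul_assoc, LinearMap.map_smul, smul_algebra_smul_comm, hf2,
      smul_algebra_smul_comm (l u) (ι k h) (ι k v • f x)]
  obtain ⟨θ, hθ, hθι⟩ := exists_derivation ψ fun u x => by
    rw [hψ, hψ, hcomm, smul_algebra_smul_comm, ← smul_add, ← mul_smul, ← mul_smul, ← add_smul,
      ι_add_mul_swap, zero_smul, smul_zero]
  obtain ⟨p, hp0, hp⟩ := F.exists_commutator_eq_of_ext_subsingleton hF hθ fun u j x hx => by
    rw [hθι, hψ]
    exact Submodule.smul_mem _ _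
      (by exact_mod_cast smul_mem_graded (ι_mem_exteriorPower_one h) (hf0 j x hx))
  have hpv : ∀ x, p (ι k v • x) = ι k v • p x + ι k h • f x := fun x => by
    rw [hp, hθι, hψ, hv, one_smul]
  refine ⟨⟨p, hp0, fun u hu x => ?_, fun x => ?_⟩, hpv⟩
  · rw [hp, hθι, hψ, LinearMap.mem_ker.1 hu, zero_smul, add_zero]
  · rw [hpv, smul_add, ← mul_smul (ι k h) (ι k h), ι_sq_zero, zero_smul, add_zero]

theorem ext_one_nontrivial_of_hyperplane [Nontrivial X] [FiniteDimensional k X]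
    [DirectSum.Decomposition 𝒳] [SetLike.GradedSMul (extGrading k V) 𝒳]
    (F : GradedFreeResolution V 𝒳) (hv : l v = 1)
    (hinj : ∀ x ∈ 𝒳 0, ι k h • x = 0 → x = 0)
    (hgen : ∀ f : Module.End k X, (∀ u ∈ LinearMap.ker l, ∀ x, f (ι k u • x) = ι k u • f x) →
      (∀ x ∈ 𝒳 0, f x = 0) → f = 0) :
    Nontrivial (F.Ext 𝒳 1) := by
  by_contra hF
  -- The identity commutes with v, so it is related to 0 and breaks injectivity of the second
  -- projection.
  let e : deformations 𝒳 l v h :=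
    ⟨LinearMap.id, fun _ _ hx => hx, fun _ _ _ => rfl, fun _ => rfl⟩
  have he : (e, 0) ∈ deformationPairs 𝒳 l v h := fun x => by
    change ι k v • x = ι k v • x + ι k h • (0 : X)
    rw [smul_zero, add_zero]
  have h5 : e = 0 := eq_zero_of_mem_relation (fun f hf => ?_)
    (fun f => exists_deformation_of_ext_subsingleton F hF hv f) he
  obtain ⟨x, hx⟩ := exists_ne (0 : X)
  · exact hx (LinearMap.congr_fun (congrArg Subtype.val h5) x)
  · refine Subtype.ext (hgen f.1 f.2.2.1 fun x hx => hinj _ (f.2.1 0 x hx) ?_)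
    have := hf x
    change (0 : X) = ι k v • (0 : X) + ι k h • f.1 x at this
    rw [smul_zero, zero_add] at this
    exact this.symm

end Deformation

/-! ### From the linear form to the module X. -/

section Main

variable {k V X : Type*} [Field k] [AddCommGroup V] [Module k V]
  [AddCommGroup X] [Module k X] [Module (ExteriorAlgebra k V) X]
  [IsScalarTower k (ExteriorAlgebra k V) X] {𝒳 : ℤ → Submodule k X}

/-- A map commuting with the hyperplane `ker l` is determined by its values on generators. -/
theorem eq_zero_of_commute_ker {b : ℕ}
    {π : (Fin b → ExteriorAlgebra k V) →ₗ[ExteriorAlgebra k V] X} (hπ : Function.Surjective π)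
    {l : Module.Dual k V} {v : V} (hv : l v = 1)
    (hs : ∀ x ∈ basisSpan π, ι k v • x ∈ (LinearMap.ker l).map (ι k) • basisSpan π)
    {f : Module.End k X} (hf : ∀ u ∈ LinearMap.ker l, ∀ x, f (ι k u • x) = ι k u • f x)
    (h0 : ∀ x ∈ basisSpan π, f x = 0) : f = 0 := by
  have hpow : ∀ p : ℕ, ((LinearMap.ker l).map (ι k)) ^ p • basisSpan π ≤ LinearMap.ker f := by
    intro p
    induction p with
    | zero => rw [pow_zero, Submodule.one_smul]; exact h0
    | succ p ih =>
      rw [pow_succ_smul, Submodule.smul_le]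
      rintro _ ⟨u, hu, rfl⟩ y hy
      rw [LinearMap.mem_ker, hf u hu, LinearMap.mem_ker.1 (ih hy), smul_zero]
  refine LinearMap.ext fun x => ?_
  obtain ⟨z, rfl⟩ := hπ x
  rw [apply_eq_sum_smul, map_sum]
  refine Finset.sum_eq_zero fun a _ => ?_
  generalize z a = r
  induction r using homogeneous_induction with
  | mem p r hr =>
    exact hpow p (exteriorPower_smul_le hv hs p
      (Submodule.smul_mem_smul hr (apply_single_mem_basisSpan π a)))
  | add r s hr hs => rw [add_smul, map_add, hr, hs, add_zero]

/-- If x is the image of a scalar row y and h x = 0, then y h = tD for a scalar row t. Applying l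
gives t l(D) = 0, so t = 0 and then y = 0. -/
theorem ι_smul_injective_of_vecMul_injective [DirectSum.Decomposition 𝒳]
    [SetLike.GradedSMul (extGrading k V) 𝒳] {L : GradedFreeResolution V 𝒳}
    (hdeg : ∀ i a, L.deg i a = i) {D : Fin (L.rank 1) → Fin (L.rank 0) → V}
    (hD : L.d 0 = linearMatrixMap k D) {l : Module.Dual k V}
    (hl : ∀ z, Matrix.vecMul z (evalMatrix l D) = 0 → z = 0) {h : V} (hh : l h = 0) (h0 : h ≠ 0)
    {x : X} (hx : x ∈ 𝒳 0) (hhx : ι k h • x = 0) : x = 0 := by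
  obtain ⟨z, hz, rfl⟩ := L.exists_homogeneous_aug_eq hx
  have hz' : ∀ a, ∃ c : k, algebraMap k (ExteriorAlgebra k V) c = z a := fun a => by
    have h1 := hz a
    rw [hdeg, Nat.cast_zero, sub_zero] at h1
    exact exteriorPower_zero_eq_algebraMap h1
  choose y hy using hz'
  rw [← map_smul] at hhx
  obtain ⟨w, hw⟩ := (L.exact_aug _).1 hhx
  rw [hD] at hw
  have hmem : ∀ a, (ι k h • z) a ∈ ⋀[k]^(0 + 1) V := fun a => by
    rw [Pi.smul_apply, smul_eq_mul, ← hy, ← Algebra.commutes, ← Algebra.smul_def]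
    exact Submodule.smul_mem _ _ (ι_mem_exteriorPower_one h)
  obtain ⟨w', hw', hw''⟩ := exists_homogeneous_preimage hmem hw
  choose t ht using fun i => exteriorPower_zero_eq_algebraMap (hw' i)
  have e : ∀ a, ∑ i, t i • D i a = y a • h := fun a => by
    have h1 := congrFun hw'' a
    rw [← show (fun i => algebraMap k (ExteriorAlgebra k V) (t i)) = w' from funext ht,
      linearMatrixMap_algebraMap, Pi.smul_apply, smul_eq_mul, ← hy, ← Algebra.commutes,
      ← Algebra.smul_def, ← map_smul, ι_inj] at h1
    exact h1
  have ht0 : t = 0 := hl t (funext fun a => by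
    rw [vecMul_evalMatrix, e, map_smul, hh, smul_zero, Pi.zero_apply])
  have hz0 : z = 0 := funext fun a => by
    have h1 := e a
    rw [ht0] at h1
    simp only [Pi.zero_apply, zero_smul, Finset.sum_const_zero] at h1
    rw [← hy, (smul_eq_zero.1 h1.symm).resolve_right h0, map_zero, Pi.zero_apply]
  rw [hz0, map_zero]

end Main

end ExteriorModules

theorem proposition4p2 {k V X : Type*} [Field k] [IsAlgClosed k]
    [AddCommGroup V] [Module k V] (n : ℕ) (hn : 1 ≤ n) (hV : Module.finrank k V = n + 1)
    [AddCommGroup X] [Module k X] [Module (ExteriorAlgebra k V) X]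
    [IsScalarTower k (ExteriorAlgebra k V) X] [Module.Finite (ExteriorAlgebra k V) X]
    (𝒳 : ℤ → Submodule k X) [DirectSum.Decomposition 𝒳]
    [SetLike.GradedSMul (ExteriorModules.extGrading k V) 𝒳]
    (hind : ExteriorModules.IsGradedIndecomposable V 𝒳)
    (hlin : ExteriorModules.IsLinearModule V 𝒳)
    (hcx : ExteriorModules.complexity V 𝒳 = 1)
    (F : ExteriorModules.GradedFreeResolution V 𝒳) :
    Nontrivial (F.Ext 𝒳 1) := by
  have : FiniteDimensional k V := Module.finite_of_finrank_pos (by omega)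
  have : FiniteDimensional k X := Module.Finite.trans (ExteriorAlgebra k V) X
  have : Nontrivial X := hind.1
  have : Infinite k := IsAlgClosed.instInfinite
  -- The linear resolution L gives the structure of X, while the arbitrary resolution F only
  -- computes Ext.
  obtain ⟨L, hL, hdeg⟩ := hlin
  obtain ⟨D, hD⟩ := ExteriorModules.GradedFreeResolution.exists_linearMatrix hdeg
  obtain ⟨c, hc⟩ := ExteriorModules.exists_rank_le_of_complexity_eq_one hcx hL
  obtain ⟨l, v, hv, hsurj, hinj⟩ := ExteriorModules.exists_linear_form_of_linear_complex
    (D := D) hn hV (fun i => by rw [← hD, ← hD]; exact L.exact_d i)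
    (fun i z hz => funext fun a => by
      rw [← hD] at hz
      simpa using hL.algebraMapInv_eq_zero hz a) hc
    (fun Ω hΩ a => by
      rw [← hD]
      refine (L.exact_aug _).1 ?_
      have h1 : (Pi.single a Ω : Fin (L.rank 0) → ExteriorAlgebra k V) = Ω • Pi.single a 1 := by
        rw [← Pi.single_smul, smul_eq_mul, mul_one]
      rw [h1, map_smul]
      exact ExteriorModules.GradedFreeResolution.top_smul_aug_single_eq_zero hV hind hcx hL hdeg
        hΩ a)
  -- The hyperplane has dimension at least n, and n ≥ 1.
  obtain ⟨h, hh⟩ : ∃ h : LinearMap.ker l, h ≠ 0 := by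
    refine Module.finrank_pos_iff_exists_ne_zero (R := k).1 ?_
    have h1 := LinearMap.finrank_range_add_finrank_ker l
    have h2 := (Submodule.finrank_le (LinearMap.range l)).trans_eq (Module.finrank_self k)
    omega
  refine ExteriorModules.ext_one_nontrivial_of_hyperplane (h := (h : V)) F hv
    (fun x hx hhx => ExteriorModules.ι_smul_injective_of_vecMul_injective hdeg (hD 0) hinj h.2
      (fun h0 => hh (Subtype.ext h0)) hx hhx)
    (fun f hf hf0 => ExteriorModules.eq_zero_of_commute_ker L.aug_surjective hv
      (ExteriorModules.smul_mem_of_vecMul_surjective L.aug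
        (fun z => by rw [← hD]; exact (L.exact_aug _).2 ⟨z, rfl⟩) hv hsurj) hf
      fun x hx => hf0 x ?_)
  refine Submodule.span_le.2 ?_ hx
  rintro _ ⟨a, rfl⟩
  exact ExteriorModules.GradedFreeResolution.aug_single_mem hdeg a
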